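/- Let $\mathbb{D}$ be the open unit disk, $\mathbb{T}$ the unit circle, and $\mathbb{D}_1^\infty=\{\zeta\in\ell^1:\ |\zeta_n|<1 \text{ for all } n\ge 1\}$, a domain in the complex Banach space $\ell^1$ of summable sequences. Let $m_\infty$ and $m_1$ be the normalized Haar measures of the infinite torus $\mathbb{T}^\infty$ and of $\mathbb{T}$. A function $F:\mathbb{D}_1^\infty\to\mathbb{C}$ is called holomorphic if it is locally bounded and, for all $x_0\in\mathbb{D}_1^\infty$ and $x\in\ell^1$, the function $z\mapsto F(x_0+zx)$ is holomorphic on $\{z\in\mathbb{C}: x_0+zx\in\mathbb{D}_1^\infty\}$. For $0<r<1$ put $F_{[r]}(w)=F(rw_1,r^2w_2,\ldots,r^nw_n,\ldots)$, $w\in\mathbb{T}^\infty$. The Nevanlinna class $N(\mathbb{D}_1^\infty)$ consists of all holomorphic $F$ on $\mathbb{D}_1^\infty$ with $$\sup_{0<r<1}\int_{\mathbb{T}^\infty}\log^+|F_{[r]}|\,dm_\infty<\infty,$$ and $N(\mathbb{D})$ consists of all holomorphic $f$ on $\mathbb{D}$ with $\sup_{0<r<1}\int_{\mathbb{T}}\log^+|f(r\lambda)|\,dm_1(\lambda)<\infty$.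 **Theorem.** Let $F\in N(\mathbb{D}_1^\infty)$ be not identically zero. Then for $m_\infty$-almost every $w\in\mathbb{T}^\infty$ the slice function $F_w(z)=F(zw_1,z^2w_2,\ldots,z^nw_n,\ldots)$, $z\in\mathbb{D}$, belongs to $N(\mathbb{D})$. Furthermore, for $m_\infty$-almost every $w\in\mathbb{T}^\infty$ the radial limit $$F^*(w)=\lim_{r\to1^-}F_{[r]}(w)$$ exists in $\mathbb{C}$, and $\log|F^*|\in L^1(\mathbb{T}^\infty,m_\infty)$ (with $\log 0=-\infty$, so that in particular $F^*\neq0$ almost everywhere). -/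

import Mathlib

open MeasureTheory Filter Topology
open scoped ENNReal Real

noncomputable section

namespace InfNevanlinna

/-- The complex Banach space `ℓ¹` of summable sequences; the coordinate `ζ_{n+1}` is `ζ n`. -/
abbrev EllOne : Type := lp (fun _ : ℕ => ℂ) 1

/-- The domain `𝔻₁^∞ = ℓ¹ ∩ 𝔻^∞` of `ℓ¹`. -/
def discOne : Set EllOne := {ζ | ∀ n, ‖ζ n‖ < 1}

/-- The infinite torus `𝕋^∞`, a compact group under coordinatewise multiplication. -/
abbrev InfTorus : Type := ℕ → Circle

instance : MeasurableSpace Circle := borel Circle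

instance : BorelSpace Circle := ⟨rfl⟩

instance : SecondCountableTopology Circle :=
  TopologicalSpace.Subtype.secondCountableTopology _

/-- The normalized (total mass `1`) Haar measure of a compact group. -/
def normHaar (G : Type*) [Group G] [TopologicalSpace G] [IsTopologicalGroup G] [CompactSpace G]
    [MeasurableSpace G] [BorelSpace G] : Measure G :=
  Measure.haarMeasure (⊤ : TopologicalSpace.PositiveCompacts G)

/-- Holomorphy on an open subset `V` of a complex Banach space: local boundedness together with
holomorphy along complex lines. -/
def HolomorphicOn {X : Type*} [NormedAddCommGroup X] [NormedSpace ℂ X]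
    (F : X → ℂ) (V : Set X) : Prop :=
  (∀ x ∈ V, ∃ U ∈ 𝓝 x, ∃ C : ℝ, ∀ y ∈ U ∩ V, ‖F y‖ ≤ C) ∧
  (∀ x₀ ∈ V, ∀ x : X, DifferentiableOn ℂ (fun z : ℂ => F (x₀ + z • x)) {z : ℂ | x₀ + z • x ∈ V})

theorem memlp_starPoint {z : ℂ} (hz : ‖z‖ < 1) (w : InfTorus) :
    Memℓp (fun n : ℕ => z ^ (n + 1) * (w n : ℂ)) 1 := by
  apply memℓp_gen
  have h : Summable fun n : ℕ => ‖z‖ ^ (n + 1) :=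
    (summable_nat_add_iff 1).2 (summable_geometric_of_lt_one (norm_nonneg z) hz)
  simpa [Circle.norm_coe] using h

open Classical in
/-- The point `z ⋆ w = (z w₁, z² w₂, …, zⁿ wₙ, …)` of `ℓ¹`, for `z` in the open unit disc and
`w ∈ 𝕋^∞`. It is only used for `‖z‖ < 1`, where the sequence is summable by `memlp_starPoint`. -/
def starPoint (z : ℂ) (w : InfTorus) : EllOne :=
  if h : Memℓp (fun n : ℕ => z ^ (n + 1) * (w n : ℂ)) 1 then ⟨_, h⟩ else 0

theorem starPoint_apply {z : ℂ} (hz : ‖z‖ < 1) (w : InfTorus) (n : ℕ) :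
    starPoint z w n = z ^ (n + 1) * (w n : ℂ) := by
  rw [starPoint, dif_pos (memlp_starPoint hz w)]

theorem starPoint_mem_discOne {z : ℂ} (hz : ‖z‖ < 1) (w : InfTorus) : starPoint z w ∈ discOne := by
  intro n
  rw [starPoint_apply hz]
  simpa [Circle.norm_coe] using pow_lt_one₀ (norm_nonneg z) hz (Nat.succ_ne_zero n)

/-- The dilation `F_{[r]}(w) = F(r w₁, r² w₂, …)`, a function on `𝕋^∞`, for `0 < r < 1`. -/
def dilation (F : EllOne → ℂ) (r : ℝ) (w : InfTorus) : ℂ := F (starPoint (r : ℂ) w)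

/-- The slice function `F_w(z) = F(z w₁, z² w₂, …)` on the open unit disc. -/
def slice (F : EllOne → ℂ) (w : InfTorus) (z : ℂ) : ℂ := F (starPoint z w)

/-- The Nevanlinna class `N(𝔻₁^∞)`. -/
def NevanlinnaInf (F : EllOne → ℂ) : Prop :=
  HolomorphicOn F discOne ∧
  (⨆ r ∈ Set.Ioo (0 : ℝ) 1,
    ∫⁻ w, ENNReal.ofReal (Real.posLog ‖dilation F r w‖) ∂(normHaar InfTorus)) < ∞

/-- The Nevanlinna class `N(𝔻)` of the open unit disc. -/
def NevanlinnaDisc (f : ℂ → ℂ) : Prop :=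
  DifferentiableOn ℂ f (Metric.ball 0 1) ∧
  (⨆ r ∈ Set.Ioo (0 : ℝ) 1,
    ∫⁻ l : Circle, ENNReal.ofReal (Real.posLog ‖f ((r : ℂ) * (l : ℂ))‖) ∂(normHaar Circle)) < ∞

/-- The radial limit `F^*(w) = lim_{r → 1⁻} F_{[r]}(w)` (an arbitrary value where the limit does
not exist). -/
def radialLimit (F : EllOne → ℂ) (w : InfTorus) : ℂ :=
  limUnder (𝓝[<] (1 : ℝ)) (fun r => dilation F r w)

end InfNevanlinna

end

noncomputable section

namespace InfNevanlinna

/-! ### Normalized Haar measure on a compact group. -/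

section Haar

variable {G : Type*} [Group G] [TopologicalSpace G] [IsTopologicalGroup G] [CompactSpace G]
    [MeasurableSpace G] [BorelSpace G]

/-! Rotating the disc variable of a slice by `λ` translates `w` by `(λ, λ², λ³, …)`. Haar measure is
invariant under these translations, so by Tonelli a torus integral of `F_{[r]}` is the average over
`w` of circle integrals of `F_w` (`lintegral_slice`). Circle means of `log⁺|F_w|` increase with the
radius, so monotone convergence puts almost every slice in `N(𝔻)`. Such slices have radial limits at
almost every `λ`, and `ae_of_ae_translate` turns this into radial limits at almost every `w`.

On the disc, Poisson integrals are replaced by real parts of polynomials slightly above `log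
max(|f|, m)` on the circle (`exists_polynomial_majorant`). These give monotone means, Jensen's
inequality, a Harnack inequality for `-log|f|`, and, with Montel's theorem, a bounded `g` with `g 0
≠ 0` and `f g` bounded. Fatou's theorem for bounded functions then applies to `g` and `f g`.

Fatou's lemma gives integrability of `log|F*|` once the integrals of `log⁺|F_{[r]}|` and
`log⁻|F_{[r]}|` are bounded along radii tending to 1. The first bound is the hypothesis. Jensen on
slices reduces the second to finiteness at a single radius. `F` may vanish at the origin, so the
centre of the slices is no starting point. Instead `F ≠ 0` at some finitely supported point, and
Harnack's inequality moves its finitely many nonzero coordinates to the circle one at a time. All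
remaining coordinates move together from 0, at the cost of a factor 1
(`lintegral_negLog_polydisc_lt_top`). -/

instance : (normHaar G).IsMulLeftInvariant := by
  unfold normHaar; infer_instance

instance : IsProbabilityMeasure (normHaar G) := by
  constructor
  simpa [normHaar] using Measure.haarMeasure_self (K₀ := (⊤ : TopologicalSpace.PositiveCompacts G))

theorem integrable_of_continuous {E : Type*} [NormedAddCommGroup E] [SecondCountableTopology E]
    {f : G → E} (hf : Continuous f) : Integrable f (normHaar G) := by
  borelize E
  obtain ⟨C, hC⟩ := (isCompact_range hf).isBounded.exists_norm_le
  exact Integrable.of_bound (C := C) hf.measurable.aestronglyMeasurable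
    (.of_forall fun x => hC _ ⟨x, rfl⟩)

end Haar

/-! ### Polynomial majorants, means over circles and Harnack's inequality. -/

/-- Real parts of polynomials are uniformly dense in the continuous functions on the circle. -/
theorem exists_polynomial_re_near (u : Circle → ℝ) (hu : Continuous u) {ε : ℝ} (hε : 0 < ε) :
    ∃ p : Polynomial ℂ, ∀ l : Circle, |(p.eval (l : ℂ)).re - u l| < ε := by
  let g : C(AddCircle (1 : ℝ), ℂ) :=
    ⟨fun x => (u (AddCircle.toCircle x) : ℂ), by
      exact Complex.continuous_ofReal.comp (hu.comp AddCircle.continuous_toCircle)⟩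
  have hg : g ∈ (Submodule.span ℂ (Set.range <| @fourier 1)).topologicalClosure := by
    rw [span_fourier_closure_eq_top]; trivial
  obtain ⟨h, hh, hgh⟩ := Metric.mem_closure_iff.1 hg ε hε
  have key : ∃ p q : Polynomial ℂ, ∀ x : AddCircle (1 : ℝ),
      h x = p.eval (AddCircle.toCircle x : ℂ)
        + starRingEnd ℂ (q.eval (AddCircle.toCircle x : ℂ)) := by
    clear hgh
    refine Submodule.span_induction (p := fun h _ => ∃ p q : Polynomial ℂ,
      ∀ x : AddCircle (1 : ℝ), h x = p.eval (AddCircle.toCircle x : ℂ)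
        + starRingEnd ℂ (q.eval (AddCircle.toCircle x : ℂ))) ?_ ?_ ?_ ?_ hh
    · rintro _ ⟨n, rfl⟩
      obtain ⟨k, rfl | rfl⟩ := n.eq_nat_or_neg
      · refine ⟨Polynomial.X ^ k, 0, fun x => ?_⟩
        simp [fourier_apply, AddCircle.toCircle_nsmul]
      · refine ⟨0, Polynomial.X ^ k, fun x => ?_⟩
        rw [fourier_neg]
        simp [fourier_apply, AddCircle.toCircle_nsmul]
    · exact ⟨0, 0, fun x => by simp⟩
    · rintro a b _ _ ⟨p, q, h1⟩ ⟨p', q', h2⟩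
      refine ⟨p + p', q + q', fun x => ?_⟩
      simp [h1, h2]; ring
    · rintro c a _ ⟨p, q, h1⟩
      refine ⟨Polynomial.C c * p, Polynomial.C (starRingEnd ℂ c) * q, fun x => ?_⟩
      simp [h1]; ring
  obtain ⟨p, q, hpq⟩ := key
  -- Conjugation does not change real parts, so `p + q` and `p + conj q` have the same real part.
  refine ⟨p + q, fun l => ?_⟩
  obtain ⟨x, rfl⟩ := (AddCircle.homeomorphCircle (one_ne_zero : (1 : ℝ) ≠ 0)).surjective l
  have h1 := (ContinuousMap.dist_lt_iff hε).1 hgh x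
  rw [dist_comm, dist_eq_norm] at h1
  refine lt_of_le_of_lt ?_ h1
  refine le_trans (le_of_eq ?_) (Complex.abs_re_le_norm _)
  rw [hpq]
  simp [g, AddCircle.homeomorphCircle_apply]

/-- Rotation by such a `c` changes the sign of `l ^ n`, so invariance forces its Haar integral to
vanish. -/
theorem exists_circle_pow_ne_one {n : ℕ} (hn : n ≠ 0) : ∃ c : Circle, (c : ℂ) ^ n = -1 := by
  refine ⟨Circle.exp (π / n), ?_⟩
  rw [Circle.coe_exp, ← Complex.exp_nat_mul, ← Complex.exp_pi_mul_I]
  congr 1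
  have : (n : ℂ) ≠ 0 := by exact_mod_cast hn
  push_cast
  field_simp

theorem integral_polynomial_circle (p : Polynomial ℂ) (s : ℂ) :
    ∫ l : Circle, p.eval (s * (l : ℂ)) ∂(normHaar Circle) = p.eval 0 := by
  induction p using Polynomial.induction_on' with
  | add p q hp hq =>
    simp only [Polynomial.eval_add]
    rw [integral_add, hp, hq] <;>
    exact integrable_of_continuous (by fun_prop)
  | monomial n a =>
    simp only [Polynomial.eval_monomial, mul_pow, ← mul_assoc]
    rw [integral_const_mul]
    by_cases hn : n = 0
    · simp [hn]
    obtain ⟨c, hc⟩ := exists_circle_pow_ne_one hn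
    have h := integral_mul_left_eq_self (μ := normHaar Circle) (fun l : Circle => (l : ℂ) ^ n) c
    simp only [Circle.coe_mul, mul_pow, hc, integral_const_mul] at h
    have h0 : ∫ l : Circle, (l : ℂ) ^ n ∂(normHaar Circle) = 0 := by linear_combination (-1 / 2) * h
    simp [h0, hn]

theorem integral_polynomial_re_circle (p : Polynomial ℂ) (s : ℂ) :
    ∫ l : Circle, (p.eval (s * (l : ℂ))).re ∂(normHaar Circle) = (p.eval 0).re := by
  rw [← integral_polynomial_circle p s]
  exact integral_re (integrable_of_continuous
    (f := fun l : Circle => p.eval (s * (l : ℂ))) (by fun_prop))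

/-- Maximum principle for `exp (-p) * f`, whose modulus is `‖f‖ exp (-Re p)`. -/
theorem norm_le_exp_re_of_circle {f : ℂ → ℂ} (hf : DiffContOnCl ℂ f (Metric.ball 0 1))
    (p : Polynomial ℂ) (h : ∀ l : Circle, ‖f l‖ ≤ Real.exp (p.eval (l : ℂ)).re) {z : ℂ}
    (hz : z ∈ Metric.closedBall (0 : ℂ) 1) : ‖f z‖ ≤ Real.exp (p.eval z).re := by
  have h1 : DiffContOnCl ℂ (fun z => Complex.exp (-p.eval z) • f z) (Metric.ball 0 1) := by
    refine DiffContOnCl.smul (Differentiable.diffContOnCl ?_) hf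
    fun_prop
  have h2 := Complex.norm_le_of_forall_mem_frontier_norm_le Metric.isBounded_ball h1 (C := 1)
    (by
      intro w hw
      rw [frontier_ball _ one_ne_zero] at hw
      have := h ⟨w, by simpa [Submonoid.unitSphere] using hw⟩
      simp only at this
      rw [norm_smul, Complex.norm_exp, Complex.neg_re, Real.exp_neg,
        inv_mul_le_iff₀ (Real.exp_pos _)]
      simpa using this) (by rwa [closure_ball _ one_ne_zero])
  simpa [norm_smul, Complex.norm_exp, Real.exp_neg, inv_mul_le_iff₀ (Real.exp_pos _)] using h2

theorem _root_.DiffContOnCl.continuous_circle {f : ℂ → ℂ}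
    (hf : DiffContOnCl ℂ f (Metric.ball 0 1)) {s : ℂ} (hs : ‖s‖ ≤ 1) :
    Continuous fun l : Circle => f (s * l) := by
  have h := hf.continuousOn
  rw [closure_ball _ one_ne_zero] at h
  exact h.comp_continuous (by fun_prop) (fun l => by simpa [Circle.norm_coe] using hs)

theorem continuous_log_max {α : Type*} [TopologicalSpace α] {g : α → ℝ} (hg : Continuous g) {m : ℝ}
    (hm : 0 < m) : Continuous fun x => Real.log (max (g x) m) :=
  (hg.max continuous_const).log fun _ => (hm.trans_le (le_max_right _ _)).ne'

/-- The real part of a polynomial can be chosen slightly above `log (max ‖f‖ m)` on the unit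
circle; it then majorizes this function on the disc. -/
theorem exists_polynomial_majorant {f : ℂ → ℂ} (hf : DiffContOnCl ℂ f (Metric.ball 0 1))
    {m : ℝ} (hm : 0 < m) {ε : ℝ} (hε : 0 < ε) :
    ∃ p : Polynomial ℂ,
      (∀ l : Circle, (p.eval (l : ℂ)).re ≤ Real.log (max ‖f l‖ m) + ε) ∧
      ∀ z ∈ Metric.closedBall (0 : ℂ) 1, Real.log (max ‖f z‖ m) ≤ (p.eval z).re := by
  have hc : Continuous fun l : Circle => Real.log (max ‖f l‖ m) := by
    refine continuous_log_max ?_ hm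
    simpa using (hf.continuous_circle (s := 1) (by simp)).norm
  -- Aiming at `log max + ε / 2` with error `ε / 2` places `Re p` between `log max` and `log max +
  -- ε`.
  obtain ⟨p, hp⟩ := exists_polynomial_re_near (fun l => Real.log (max ‖f l‖ m) + ε / 2)
    (by fun_prop) (half_pos hε)
  have hlow (l : Circle) : max ‖f l‖ m ≤ Real.exp (p.eval (l : ℂ)).re := by
    rw [← Real.log_le_iff_le_exp (hm.trans_le (le_max_right _ _))]
    linarith [(abs_lt.1 (hp l)).1]
  refine ⟨p, fun l => by linarith [(abs_lt.1 (hp l)).2], fun z hz => ?_⟩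
  rw [Real.log_le_iff_le_exp (hm.trans_le (le_max_right _ _))]
  refine max_le (norm_le_exp_re_of_circle hf p (fun l => (le_max_left _ _).trans (hlow l)) hz) ?_
  -- The maximum principle for the constant `m` handles the other entry of the maximum.
  have := norm_le_exp_re_of_circle (f := fun _ => (m : ℂ)) diffContOnCl_const p
    (fun l => by simpa [abs_of_pos hm] using (le_max_right _ _).trans (hlow l)) hz
  simpa [abs_of_pos hm] using this

/-- Circle means of `log (max ‖f‖ m)` increase with the radius. -/
theorem integral_log_max_le {f : ℂ → ℂ} (hf : DiffContOnCl ℂ f (Metric.ball 0 1))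
    {m : ℝ} (hm : 0 < m) {s : ℂ} (hs : ‖s‖ ≤ 1) :
    ∫ l : Circle, Real.log (max ‖f (s * l)‖ m) ∂(normHaar Circle)
      ≤ ∫ l : Circle, Real.log (max ‖f l‖ m) ∂(normHaar Circle) := by
  refine le_of_forall_pos_le_add fun ε hε => ?_
  obtain ⟨p, hp1, hp2⟩ := exists_polynomial_majorant hf hm hε
  have hc {s : ℂ} (hs : ‖s‖ ≤ 1) : Integrable (fun l : Circle => Real.log (max ‖f (s * l)‖ m))
      (normHaar Circle) :=
    integrable_of_continuous (continuous_log_max (hf.continuous_circle hs).norm hm)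
  have hi (s : ℂ) : Integrable (fun l : Circle => (p.eval (s * (l : ℂ))).re) (normHaar Circle) :=
    integrable_of_continuous (by fun_prop)
  calc ∫ l : Circle, Real.log (max ‖f (s * l)‖ m) ∂(normHaar Circle)
      ≤ ∫ l : Circle, (p.eval (s * (l : ℂ))).re ∂(normHaar Circle) :=
        integral_mono (hc hs) (hi s) fun l => hp2 _ (by simpa [Circle.norm_coe] using hs)
    -- Both means equal `Re p(0)`.
    _ = ∫ l : Circle, (p.eval (1 * (l : ℂ))).re ∂(normHaar Circle) := by
        rw [integral_polynomial_re_circle, integral_polynomial_re_circle]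
    _ ≤ ∫ l : Circle, (Real.log (max ‖f (1 * l)‖ m) + ε) ∂(normHaar Circle) :=
        integral_mono (hi 1) ((hc (by simp)).add (integrable_const _)) fun l => by
          simpa using hp1 l
    _ = _ := by
        rw [integral_add (hc (by simp)) (integrable_const _)]; simp

/-- Harnack's inequality, comparing the centre of the disc with a point `a`. -/
theorem polynomial_re_zero_le {p : Polynomial ℂ} (hp : ∀ l : Circle, 0 ≤ (p.eval (l : ℂ)).re)
    {a : ℂ} (ha : ‖a‖ < 1) :
    (1 - ‖a‖) / (1 + ‖a‖) * (p.eval 0).re ≤ (p.eval a).re := by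
  have hd : DiffContOnCl ℂ (fun z => p.eval z) (Metric.ball 0 1) :=
    Differentiable.diffContOnCl (by fun_prop)
  have ha' : a ∈ Metric.ball (0 : ℂ) 1 := by simpa using ha
  have hcp : ContinuousOn (fun z => p.eval z) (Metric.sphere (0 : ℂ) |1|) :=
    Continuous.continuousOn (by fun_prop)
  have h1 := hd.circleAverage_re_herglotzRieszKernel_smul' ha'
  have hk : ContinuousOn (fun z : ℂ => ((z - 0 + (a - 0)) / (z - 0 - (a - 0))).re)
      (Metric.sphere 0 |1|) :=
    Complex.continuous_re.comp_continuousOn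
      (continuousOn_herglotzRieszKernel_sphere ha')
  have e1 : (p.eval a).re = Real.circleAverage
      (fun z => ((z - 0 + (a - 0)) / (z - 0 - (a - 0))).re * (p.eval z).re) 0 1 := by
    rw [← h1, ← Complex.reCLM_apply, ← ContinuousLinearMap.circleAverage_comp_comm]
    · congr 1; ext z; simp
    · exact (hk.smul hcp).circleIntegrable'
  have e0 : (p.eval 0).re = Real.circleAverage (fun z => (p.eval z).re) 0 1 := by
    have h2 : Real.circleAverage (fun z => p.eval z) 0 1 = p.eval 0 :=
      DiffContOnCl.circleAverage (by simpa using hd)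
    rw [← h2, ← Complex.reCLM_apply,
      ← ContinuousLinearMap.circleAverage_comp_comm]
    · rfl
    · exact hcp.circleIntegrable'
  have hcr : ContinuousOn (fun z => (p.eval z).re) (Metric.sphere (0 : ℂ) |1|) :=
    Complex.continuous_re.comp_continuousOn hcp
  rw [e1, e0, ← smul_eq_mul, ← Real.circleAverage_fun_smul]
  have hcs : ContinuousOn (fun z => ((1 - ‖a‖) / (1 + ‖a‖)) • (p.eval z).re)
      (Metric.sphere (0 : ℂ) |1|) := by
    fun_prop
  refine Real.circleAverage_mono hcs.circleIntegrable'
    (hk.mul hcr).circleIntegrable' fun z hz => ?_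
  have hz1 : z ∈ Metric.sphere (0 : ℂ) 1 := by simpa using hz
  -- The Poisson kernel at `a` is at least `(1 - ‖a‖) / (1 + ‖a‖)`, and it is integrated against a
  -- nonnegative function.
  have := le_re_herglotzRieszKernel hz1 ha'
  rw [smul_eq_mul]
  refine mul_le_mul_of_nonneg_right (by simpa using this) ?_
  exact hp ⟨z, by simpa [Submonoid.unitSphere] using hz1⟩

/-! ### Negative part of the logarithm and Jensen's inequality. -/

/-- The negative part of the logarithm, truncated at `k`. -/
def negLogTrunc (k : ℕ) (x : ℝ) : ℝ := -Real.log (max (min x 1) (Real.exp (-k)))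

/-- The negative part of `log ‖z‖`, with value `∞` at `0`. -/
def negLog (z : ℂ) : ℝ≥0∞ := ⨆ k, ENNReal.ofReal (negLogTrunc k ‖z‖)

theorem exp_neg_natCast_le_one (k : ℕ) : Real.exp (-(k : ℝ)) ≤ 1 :=
  Real.exp_le_one_iff.2 (by simp)

theorem negLogTrunc_nonneg (k : ℕ) (x : ℝ) : 0 ≤ negLogTrunc k x := by
  rw [negLogTrunc, neg_nonneg]
  exact Real.log_nonpos ((Real.exp_pos _).le.trans (le_max_right _ _))
    (max_le (min_le_right _ _) (exp_neg_natCast_le_one k))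

theorem continuous_negLogTrunc (k : ℕ) : Continuous (negLogTrunc k) :=
  (continuous_log_max (by fun_prop) (Real.exp_pos _)).neg

theorem negLogTrunc_mono (x : ℝ) : Monotone fun k => negLogTrunc k x := by
  intro j k hjk
  refine neg_le_neg (Real.log_le_log ((Real.exp_pos _).trans_le (le_max_right _ _)) ?_)
  gcongr

/-- Makes the estimates for `log max(‖f‖, m)`, with `m = exp (-k)`, statements about positive and
truncated negative parts; `k → ∞` is then monotone convergence. -/
theorem log_max_exp_neg (k : ℕ) {x : ℝ} (hx : 0 ≤ x) :
    Real.log (max x (Real.exp (-k))) = Real.posLog x - negLogTrunc k x := by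
  have h1 := exp_neg_natCast_le_one k
  have h2 : max x (Real.exp (-k)) = max 1 x * max (min x 1) (Real.exp (-k)) := by
    rcases le_total x 1 with h | h
    · simp [h]
    · rw [max_eq_left (h1.trans h), max_eq_right h, min_eq_right h, max_eq_left h1, mul_one]
  rw [h2, Real.log_mul (by positivity) (by positivity), Real.posLog_eq_log_max_one hx, negLogTrunc]
  ring

theorem measurable_negLog : Measurable negLog :=
  .iSup fun k => ((continuous_negLogTrunc k).comp continuous_norm).measurable.ennreal_ofReal

theorem negLog_zero : negLog 0 = ∞ := by
  refine ENNReal.eq_top_of_forall_nnreal_le fun r => ?_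
  obtain ⟨k, hk⟩ := exists_nat_ge (r : ℝ)
  refine le_trans ?_ (le_iSup _ k)
  rw [← ENNReal.ofReal_coe_nnreal]
  refine ENNReal.ofReal_le_ofReal (hk.trans (le_of_eq ?_))
  simp [negLogTrunc, (Real.exp_pos _).le]

theorem negLog_lt_top {z : ℂ} (hz : z ≠ 0) : negLog z < ∞ := by
  refine lt_of_le_of_lt (iSup_le fun k => ?_)
    (ENNReal.ofReal_lt_top (r := -Real.log (min ‖z‖ 1)))
  refine ENNReal.ofReal_le_ofReal (neg_le_neg (Real.log_le_log ?_ (le_max_left _ _)))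
  exact lt_min (norm_pos_iff.2 hz) one_pos

theorem enorm_log_norm_le (z : ℂ) :
    ‖Real.log ‖z‖‖ₑ ≤ ENNReal.ofReal (Real.posLog ‖z‖) + negLog z := by
  by_cases hz : z = 0
  · simp [hz]
  obtain ⟨k, hk⟩ := exists_nat_ge (-Real.log ‖z‖)
  have h1 : Real.exp (-k) ≤ ‖z‖ := by
    rw [← Real.le_log_iff_exp_le (norm_pos_iff.2 hz)]; linarith
  have h2 := log_max_exp_neg k (norm_nonneg z)
  rw [max_eq_left h1] at h2
  have h3 := negLogTrunc_nonneg k ‖z‖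
  have h4 : 0 ≤ Real.posLog ‖z‖ := Real.posLog_nonneg
  rw [← ofReal_norm, h2]
  calc _ ≤ ENNReal.ofReal (Real.posLog ‖z‖ + negLogTrunc k ‖z‖) := by
        refine ENNReal.ofReal_le_ofReal ?_
        rw [Real.norm_eq_abs, abs_le]
        constructor <;> linarith
    _ ≤ _ := by
        rw [ENNReal.ofReal_add h4 h3]
        gcongr
        exact le_iSup (fun k => ENNReal.ofReal (negLogTrunc k ‖z‖)) k

/-- Lower semicontinuity: `negLog` is a supremum of continuous functions. -/
theorem negLog_le_liminf {ι : Type*} {F : Filter ι} [F.NeBot] {g : ι → ℂ} {c : ℂ}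
    (h : Tendsto g F (𝓝 c)) : negLog c ≤ liminf (fun i => negLog (g i)) F := by
  refine iSup_le fun k => ?_
  have h1 : Tendsto (fun i => ENNReal.ofReal (negLogTrunc k ‖g i‖)) F
      (𝓝 (ENNReal.ofReal (negLogTrunc k ‖c‖))) :=
    ENNReal.tendsto_ofReal (((continuous_negLogTrunc k).tendsto _).comp h.norm)
  rw [← h1.liminf_eq]
  exact liminf_le_liminf
    (.of_forall fun i => le_iSup (fun k => ENNReal.ofReal (negLogTrunc k ‖g i‖)) k)

theorem lintegral_negLog {α : Type*} [MeasurableSpace α] (μ : Measure α) {g : α → ℂ}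
    (hg : Measurable g) :
    ∫⁻ x, negLog (g x) ∂μ = ⨆ k, ∫⁻ x, ENNReal.ofReal (negLogTrunc k ‖g x‖) ∂μ := by
  refine lintegral_iSup (fun k => ?_) fun j k hjk x =>
    ENNReal.ofReal_le_ofReal (negLogTrunc_mono _ hjk)
  exact ((continuous_negLogTrunc k).measurable.comp hg.norm).ennreal_ofReal

theorem ofReal_integral_circle {g : Circle → ℝ} (hg : Continuous g) (h0 : ∀ x, 0 ≤ g x) :
    ENNReal.ofReal (∫ l, g l ∂(normHaar Circle))
      = ∫⁻ l, ENNReal.ofReal (g l) ∂(normHaar Circle) :=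
  ofReal_integral_eq_lintegral_ofReal (integrable_of_continuous hg) (.of_forall h0)

theorem continuous_posLog_norm {α : Type*} [TopologicalSpace α] {g : α → ℂ} (hg : Continuous g) :
    Continuous fun x => Real.posLog ‖g x‖ :=
  Real.continuous_posLog.comp hg.norm

variable {f : ℂ → ℂ}

theorem _root_.DiffContOnCl.continuous_circle_one (hf : DiffContOnCl ℂ f (Metric.ball 0 1)) :
    Continuous fun l : Circle => f l := by
  simpa using hf.continuous_circle (s := 1) (by simp)

theorem lintegral_posLog_le (hf : DiffContOnCl ℂ f (Metric.ball 0 1)) {s : ℂ} (hs : ‖s‖ ≤ 1) :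
    ∫⁻ l : Circle, ENNReal.ofReal (Real.posLog ‖f (s * l)‖) ∂(normHaar Circle)
      ≤ ∫⁻ l : Circle, ENNReal.ofReal (Real.posLog ‖f l‖) ∂(normHaar Circle) := by
  rw [← ofReal_integral_circle (continuous_posLog_norm (hf.continuous_circle hs))
      (fun _ => Real.posLog_nonneg),
    ← ofReal_integral_circle (continuous_posLog_norm hf.continuous_circle_one)
      (fun _ => Real.posLog_nonneg)]
  refine ENNReal.ofReal_le_ofReal ?_
  simpa [Real.posLog_eq_log_max_one, max_comm] using integral_log_max_le hf one_pos hs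

/-- Jensen's inequality between two concentric circles. -/
theorem lintegral_negLog_le (hf : DiffContOnCl ℂ f (Metric.ball 0 1)) {s : ℂ} (hs : ‖s‖ ≤ 1) :
    ∫⁻ l : Circle, negLog (f l) ∂(normHaar Circle)
      ≤ ∫⁻ l : Circle, ENNReal.ofReal (Real.posLog ‖f l‖) ∂(normHaar Circle)
        + ∫⁻ l : Circle, negLog (f (s * l)) ∂(normHaar Circle) := by
  rw [lintegral_negLog _ hf.continuous_circle_one.measurable]
  refine iSup_le fun k => ?_
  have hA {g : Circle → ℂ} (hg : Continuous g) : Continuous fun l => negLogTrunc k ‖g l‖ :=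
    (continuous_negLogTrunc k).comp hg.norm
  have hc1 := hf.continuous_circle_one
  have hcs := hf.continuous_circle hs
  have hi1 := integrable_of_continuous (continuous_posLog_norm hc1)
  have his := integrable_of_continuous (continuous_posLog_norm hcs)
  have hj1 := integrable_of_continuous (hA hc1)
  have hjs := integrable_of_continuous (hA hcs)
  -- Monotonicity of means, split into positive and negative parts; the mean of `log⁺` on the inner
  -- circle is then dropped.
  have h := integral_log_max_le hf (Real.exp_pos (-k)) hs
  simp only [log_max_exp_neg k (norm_nonneg _)] at h
  rw [integral_sub hi1 hj1, integral_sub his hjs] at h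
  have h0 : 0 ≤ ∫ l : Circle, Real.posLog ‖f (s * l)‖ ∂(normHaar Circle) :=
    integral_nonneg fun _ => Real.posLog_nonneg
  have h2 : 0 ≤ ∫ l : Circle, Real.posLog ‖f l‖ ∂(normHaar Circle) :=
    integral_nonneg fun _ => Real.posLog_nonneg
  have h3 : 0 ≤ ∫ l : Circle, negLogTrunc k ‖f (s * l)‖ ∂(normHaar Circle) :=
    integral_nonneg fun _ => negLogTrunc_nonneg _ _
  calc _ = ENNReal.ofReal (∫ l : Circle, negLogTrunc k ‖f l‖ ∂(normHaar Circle)) :=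
        (ofReal_integral_circle (hA hc1) fun _ => negLogTrunc_nonneg _ _).symm
    _ ≤ ENNReal.ofReal (∫ l : Circle, Real.posLog ‖f l‖ ∂(normHaar Circle)
          + ∫ l : Circle, negLogTrunc k ‖f (s * l)‖ ∂(normHaar Circle)) :=
        ENNReal.ofReal_le_ofReal (by linarith)
    _ ≤ _ := by
        rw [ENNReal.ofReal_add h2 h3,
          ofReal_integral_circle (continuous_posLog_norm hc1) (fun _ => Real.posLog_nonneg),
          ofReal_integral_circle (hA hcs) fun _ => negLogTrunc_nonneg _ _]
        gcongr with l
        exact le_iSup (fun k => ENNReal.ofReal (negLogTrunc k ‖f (s * l)‖)) k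

/-- With `p` the majorant of the truncated logarithm, `ε - Re p` is harmonic, dominates the
truncation of `-log ‖f‖` on the circle, and at `a` exceeds it by at most `ε`. Its mean is its value
at 0, which Harnack compares with its value at `a`. -/
theorem lintegral_negLog_le_mul (hf : DiffContOnCl ℂ f (Metric.ball 0 1))
    (hf1 : ∀ l : Circle, ‖f l‖ ≤ 1) {a : ℂ} (ha : ‖a‖ < 1) :
    ∫⁻ l : Circle, negLog (f l) ∂(normHaar Circle)
      ≤ ENNReal.ofReal ((1 + ‖a‖) / (1 - ‖a‖)) * negLog (f a) := by
  rw [lintegral_negLog _ hf.continuous_circle_one.measurable]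
  refine iSup_le fun k => ?_
  have hA : Continuous fun l : Circle => negLogTrunc k ‖f l‖ :=
    (continuous_negLogTrunc k).comp hf.continuous_circle_one.norm
  have hlog {x : ℝ} (h : x ≤ 1) : Real.log (max x (Real.exp (-k))) = -negLogTrunc k x := by
    simp [negLogTrunc, h]
  have hfa : ‖f a‖ ≤ 1 := by
    simpa using norm_le_exp_re_of_circle hf 0 (by simpa using hf1) (by simpa using ha.le)
  have hpos : 0 < 1 - ‖a‖ := by linarith
  have hC : 0 ≤ (1 + ‖a‖) / (1 - ‖a‖) := by positivity
  rw [← ofReal_integral_circle hA fun _ => negLogTrunc_nonneg _ _]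
  calc _ ≤ ENNReal.ofReal ((1 + ‖a‖) / (1 - ‖a‖) * negLogTrunc k ‖f a‖) := ?_
    _ ≤ _ := by
      rw [ENNReal.ofReal_mul hC]
      gcongr
      exact le_iSup (fun k => ENNReal.ofReal (negLogTrunc k ‖f a‖)) k
  refine ENNReal.ofReal_le_ofReal ?_
  refine le_of_forall_pos_le_add fun δ hδ => ?_
  set C := (1 + ‖a‖) / (1 - ‖a‖) with hCdef
  obtain ⟨ε, hε, hεδ⟩ : ∃ ε > 0, C * ε ≤ δ := by
    refine ⟨δ / (C + 1), by positivity, ?_⟩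
    rw [mul_div_assoc', div_le_iff₀ (by positivity)]
    nlinarith
  obtain ⟨p, hp1, hp2⟩ := exists_polynomial_majorant hf (Real.exp_pos (-k)) hε
  have h1 (l : Circle) : negLogTrunc k ‖f l‖ ≤ ((Polynomial.C (ε : ℂ) - p).eval (l : ℂ)).re := by
    have := hp1 l
    rw [hlog (hf1 l)] at this
    simp; linarith
  have h2 : negLogTrunc k ‖f a‖ ≥ (p.eval a).re * (-1) := by
    have := hp2 a (by simpa using ha.le)
    rw [hlog hfa] at this
    linarith
  have h3 := polynomial_re_zero_le (p := Polynomial.C (ε : ℂ) - p)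
    (fun l => (negLogTrunc_nonneg _ _).trans (h1 l)) ha
  have h4 : ∫ l : Circle, negLogTrunc k ‖f l‖ ∂(normHaar Circle)
      ≤ ((Polynomial.C (ε : ℂ) - p).eval 0).re := by
    rw [← integral_polynomial_re_circle _ 1]
    exact integral_mono (integrable_of_continuous hA) (integrable_of_continuous (by fun_prop))
      fun l => by simpa using h1 l
  have h5 : ((Polynomial.C (ε : ℂ) - p).eval 0).re ≤ C * ((Polynomial.C (ε : ℂ) - p).eval a).re := by
    rw [hCdef, div_mul_eq_mul_div, le_div_iff₀ hpos]
    rw [div_mul_eq_mul_div, div_le_iff₀ (by positivity)] at h3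
    linarith
  have h6 : ((Polynomial.C (ε : ℂ) - p).eval a).re ≤ ε + negLogTrunc k ‖f a‖ := by
    simp; linarith
  nlinarith [mul_le_mul_of_nonneg_left h6 hC]

/-! ### Fatou's theorem for bounded functions. -/

section Fatou

open Metric Complex

/-- Cauchy's formula for the derivative, under continuity up to the boundary. -/
theorem deriv_eq_circleIntegral {H : ℂ → ℂ} (hH : DiffContOnCl ℂ H (ball 0 1)) {w : ℂ}
    (hw : w ∈ ball (0 : ℂ) 1) :
    deriv H w = (2 * π * I : ℂ)⁻¹ • ∮ z in C(0, 1), ((z - w) ^ 2)⁻¹ • H z := by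
  have hHd := hH.differentiableAt isOpen_ball hw
  have hcl : closure (ball (0 : ℂ) 1) ∈ 𝓝 w :=
    mem_of_superset (isOpen_ball.mem_nhds hw) subset_closure
  -- Cauchy's formula is applied to the difference quotient, whose value at `w` is the derivative;
  -- the term with `H w` integrates to zero.
  have hH' : DiffContOnCl ℂ (dslope H w) (ball 0 1) :=
    ⟨(differentiableOn_dslope (isOpen_ball.mem_nhds hw)).2 hH.differentiableOn,
      (continuousOn_dslope hcl).2 ⟨hH.continuousOn, hHd⟩⟩
  have h0 := hH'.two_pi_i_inv_smul_circleIntegral_sub_inv_smul hw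
  have hsub : sphere (0 : ℂ) 1 ⊆ closure (ball 0 1) := by
    rw [closure_ball _ one_ne_zero]; exact sphere_subset_closedBall
  rw [← dslope_same, ← h0]
  congr 1
  have h1 : ContinuousOn (fun z : ℂ => ((z - w) ^ 2)⁻¹) (sphere 0 1) := by
    refine ((continuous_id'.sub continuous_const).pow 2).continuousOn.inv₀ fun z hz h => ?_
    exact sphere_disjoint_ball.ne_of_mem hz hw (sub_eq_zero.mp (sq_eq_zero_iff.mp h))
  have h2 : CircleIntegrable (fun z : ℂ => ((z - w) ^ 2)⁻¹ • H z) 0 1 :=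
    ContinuousOn.circleIntegrable zero_le_one (h1.smul (hH.continuousOn.mono hsub))
  have h3 : CircleIntegrable (fun z : ℂ => ((z - w) ^ 2)⁻¹ • H w) 0 1 :=
    ContinuousOn.circleIntegrable zero_le_one (h1.smul continuousOn_const)
  have h4 : (∮ z : ℂ in C(0, 1), ((z - w) ^ 2)⁻¹) = 0 := by
    simpa using! circleIntegral.integral_sub_zpow_of_ne (by decide : (-2 : ℤ) ≠ -1) 0 w 1
  trans ∮ z in C(0, 1), ((z - w) ^ 2)⁻¹ • (H z - H w)
  · refine circleIntegral.integral_congr zero_le_one fun z hz => ?_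
    have hzw : z ≠ w := fun h => sphere_disjoint_ball.ne_of_mem hz hw h
    have : z - w ≠ 0 := sub_ne_zero.2 hzw
    simp only [dslope_of_ne _ hzw, slope_def_field, smul_eq_mul]
    field_simp
  · simp only [smul_sub]
    rw [circleIntegral.integral_sub h2 h3, circleIntegral.integral_smul_const, h4]
    simp

/-- Both squares equal `1 + r² - 2 r Re (z conj w)`. Hence the distance from `z` to the reflected
pole `w / r` is `1 / r` times its distance to `r w`. -/
theorem norm_sub_smul_eq {z w : ℂ} (hz : ‖z‖ = 1) (hw : ‖w‖ = 1) (r : ℝ) :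
    ‖(r : ℂ) * z - w‖ = ‖z - r * w‖ := by
  rw [← sq_eq_sq₀ (norm_nonneg _) (norm_nonneg _)]
  have h1 : ‖z‖ ^ 2 = 1 := by rw [hz]; norm_num
  have h2 : ‖w‖ ^ 2 = 1 := by rw [hw]; norm_num
  rw [Complex.sq_norm, normSq_apply] at h1 h2 ⊢
  rw [Complex.sq_norm, normSq_apply]
  simp
  linear_combination (r ^ 2 - 1) * h1 - (r ^ 2 - 1) * h2

/-- The derivative of `H` at `r ζ₀` as an average over the circle, with the pole reflected. -/
theorem deriv_eq_circleAverage {H : ℂ → ℂ} (hH : DiffContOnCl ℂ H (ball 0 1)) {w : ℂ}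
    (hw : ‖w‖ = 1) {r : ℝ} (hr0 : 0 < r) (hr1 : r < 1) :
    deriv H (r * w) = Real.circleAverage
      (fun z => z * (((z - r * w) ^ 2)⁻¹ - ((z - w / r) ^ 2)⁻¹) * H z) 0 1 := by
  have hr0' : (r : ℂ) ≠ 0 := by exact_mod_cast hr0.ne'
  have hin : (r : ℂ) * w ∈ ball (0 : ℂ) 1 := by simpa [hw, abs_of_pos hr0] using hr1
  have hout : 1 < ‖w / r‖ := by
    rw [norm_div, hw]; simp [abs_of_pos hr0, one_lt_inv₀ hr0, hr1]
  have hsub : sphere (0 : ℂ) 1 ⊆ closure (ball 0 1) := by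
    rw [closure_ball _ one_ne_zero]; exact sphere_subset_closedBall
  have hne : ∀ z ∈ closure (ball (0 : ℂ) 1), (z - w / r) ^ 2 ≠ 0 := by
    intro z hz h
    rw [closure_ball _ one_ne_zero] at hz
    have h2 : z = w / r := sub_eq_zero.mp (sq_eq_zero_iff.mp h)
    rw [mem_closedBall_zero_iff, h2] at hz
    linarith
  have hd2 : DiffContOnCl ℂ (fun z => ((z - w / r) ^ 2)⁻¹) (ball 0 1) := by
    refine DiffContOnCl.inv (Differentiable.diffContOnCl (by fun_prop)) hne
  -- The reflected pole lies outside the closed disc, so its integral vanishes and may be subtracted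
  -- freely.
  have h2 : ∮ z in C(0, 1), ((z - w / r) ^ 2)⁻¹ • H z = 0 :=
    (hd2.smul hH).circleIntegral_eq_zero zero_le_one
  have h1c : ContinuousOn (fun z : ℂ => ((z - r * w) ^ 2)⁻¹) (sphere 0 1) := by
    refine ((continuous_id'.sub continuous_const).pow 2).continuousOn.inv₀ fun z hz h => ?_
    exact sphere_disjoint_ball.ne_of_mem hz hin (sub_eq_zero.mp (sq_eq_zero_iff.mp h))
  have hi1 : CircleIntegrable (fun z : ℂ => ((z - r * w) ^ 2)⁻¹ • H z) 0 1 :=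
    ContinuousOn.circleIntegrable zero_le_one (h1c.smul (hH.continuousOn.mono hsub))
  have hi2 : CircleIntegrable (fun z : ℂ => ((z - w / r) ^ 2)⁻¹ • H z) 0 1 :=
    ContinuousOn.circleIntegrable zero_le_one ((hd2.smul hH).continuousOn.mono hsub)
  have h3 := deriv_eq_circleIntegral hH hin
  have h4 := circleIntegral.integral_sub hi1 hi2
  rw [h2, sub_zero] at h4
  rw [← h4] at h3
  rw [h3, Real.circleAverage_eq_circleIntegral one_ne_zero]
  congr 1
  refine circleIntegral.integral_congr zero_le_one fun z hz => ?_
  have hz0 : z ≠ 0 := by rintro rfl; simp at hz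
  simp only [smul_eq_mul, sub_zero]
  field_simp

/-- With `a`, `b` the differences to the two poles, the kernel is `(b - a)(b + a) / (a² b²)` and `‖b
- a‖ = (1 - r²) / r`. The factor `1 - r` gained by reflection makes the kernel times `‖z - r w‖`
comparable to the Poisson kernel; the 4 bounds `(1 + r)²`. -/
theorem norm_reflected_kernel_le {z w : ℂ} (hz : ‖z‖ = 1) (hw : ‖w‖ = 1) {r : ℝ} (hr0 : 0 < r)
    (hr1 : r < 1) :
    ‖((z - r * w) ^ 2)⁻¹ - ((z - w / r) ^ 2)⁻¹‖ ≤ 4 * (1 - r) / ‖z - r * w‖ ^ 3 := by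
  have hr0' : (r : ℂ) ≠ 0 := by exact_mod_cast hr0.ne'
  have hb : ‖z - w / r‖ = ‖z - r * w‖ / r := by
    rw [eq_div_iff hr0.ne', ← norm_sub_smul_eq hz hw]
    have : (r : ℂ) * z - w = (z - w / r) * r := by field_simp
    rw [this, norm_mul]; simp [abs_of_pos hr0]
  have ha : 0 < ‖z - r * w‖ := by
    have h := norm_sub_norm_le z (r * w)
    rw [norm_mul, hz, hw] at h
    simp [abs_of_pos hr0] at h
    linarith
  set a := z - r * w with hadef
  set b := z - w / r with hbdef
  have ha0 : a ≠ 0 := norm_pos_iff.1 ha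
  have hb0 : b ≠ 0 := norm_pos_iff.1 (hb ▸ div_pos ha hr0)
  have hba : b - a = ((r - 1 / r : ℝ) : ℂ) * w := by
    rw [hadef, hbdef]; push_cast; field_simp; ring
  have hK : (a ^ 2)⁻¹ - (b ^ 2)⁻¹ = (b - a) * (b + a) / (a ^ 2 * b ^ 2) := by
    field_simp; ring
  have h1 : ‖b - a‖ = (1 - r ^ 2) / r := by
    rw [hba, norm_mul, hw, mul_one, Complex.norm_real, Real.norm_eq_abs, abs_sub_comm,
      abs_of_nonneg]
    · field_simp
    · rw [sub_nonneg, le_div_iff₀ hr0]; nlinarith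
  have h2 : ‖b + a‖ ≤ ‖a‖ * (1 + r) / r := by
    refine (norm_add_le _ _).trans (le_of_eq ?_)
    rw [hb]; field_simp
  rw [hK, norm_div, norm_mul, norm_mul, norm_pow, norm_pow, h1, hb]
  have h3 : 0 ≤ (1 - r ^ 2) / r := div_nonneg (by nlinarith) hr0.le
  calc (1 - r ^ 2) / r * ‖b + a‖ / (‖a‖ ^ 2 * (‖a‖ / r) ^ 2)
      ≤ (1 - r ^ 2) / r * (‖a‖ * (1 + r) / r) / (‖a‖ ^ 2 * (‖a‖ / r) ^ 2) := by gcongr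
    _ = (1 + r) ^ 2 * (1 - r) / ‖a‖ ^ 3 := by field_simp; ring
    _ ≤ _ := by
      gcongr
      nlinarith

theorem circleAverage_poisson_eq_one {w : ℂ} (hw : ‖w‖ < 1) :
    Real.circleAverage (fun z => (1 - ‖w‖ ^ 2) / ‖z - w‖ ^ 2) 0 1 = 1 := by
  have hw' : w ∈ ball (0 : ℂ) 1 := by simpa using hw
  have h := (diffContOnCl_const (c := (1 : ℂ))).circleAverage_poissonKernel_smul' hw'
  have h' : Real.circleAverage (fun z => (((1 - ‖w‖ ^ 2) / ‖z - w‖ ^ 2 : ℝ) : ℂ)) 0 1 = 1 := by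
    rw [← h]
    refine Real.circleAverage_congr_sphere fun z hz => ?_
    have hz : ‖z‖ = 1 := by simpa using hz
    simp [hz]
  have hc : ContinuousOn (fun z => (((1 - ‖w‖ ^ 2) / ‖z - w‖ ^ 2 : ℝ) : ℂ)) (sphere 0 |1|) := by
    refine continuous_ofReal.comp_continuousOn (ContinuousOn.div (by fun_prop) (by fun_prop) ?_)
    intro z hz h0
    have hzw : z = w := by simpa [sub_eq_zero] using h0
    simp [hzw] at hz
    linarith
  have h2 := congrArg Complex.re h'
  rw [← Complex.reCLM_apply, ← ContinuousLinearMap.circleAverage_comp_comm _ hc.circleIntegrable']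
    at h2
  have e : (Complex.reCLM ∘ fun z => (((1 - ‖w‖ ^ 2) / ‖z - w‖ ^ 2 : ℝ) : ℂ))
      = fun z => (1 - ‖w‖ ^ 2) / ‖z - w‖ ^ 2 := by
    ext z; exact ofReal_re _
  rwa [e] at h2

/-- Near `w`, `‖H z‖ ≤ η ‖z - w‖ ≤ 2 η ‖z - r w‖`, so the integrand is at most `8 η` times the
Poisson kernel, whose mean is 1. Away from `w` it is `O(1 - r)`. -/
theorem tendsto_deriv_radial {H : ℂ → ℂ} (hH : DiffContOnCl ℂ H (ball 0 1)) {w : ℂ} (hw : ‖w‖ = 1)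
    (ho : H =o[𝓝[sphere 0 1] w] fun z => z - w) :
    Tendsto (fun r : ℝ => deriv H (r * w)) (𝓝[<] 1) (𝓝 0) := by
  have hsub : sphere (0 : ℂ) 1 ⊆ closure (ball 0 1) := by
    rw [closure_ball _ one_ne_zero]; exact sphere_subset_closedBall
  obtain ⟨C, hC⟩ := (isCompact_sphere (0 : ℂ) 1).exists_bound_of_continuousOn
    (hH.continuousOn.mono hsub)
  have hC0 : 0 ≤ C := (norm_nonneg _).trans (hC w (by simpa using hw))
  have main (η : ℝ) (hη : 0 < η) : ∃ B : ℝ, ∀ r : ℝ, 0 < r → r < 1 →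
      ‖deriv H (r * w)‖ ≤ 8 * η + B * (1 - r) := by
    obtain ⟨d, hd, hnear⟩ := Metric.mem_nhdsWithin_iff.1 (ho.def hη)
    refine ⟨32 * C / d ^ 3, fun r hr0 hr1 => ?_⟩
    have hrw : ‖(r : ℂ) * w‖ = r := by simp [hw, abs_of_pos hr0]
    rw [deriv_eq_circleAverage hH hw hr0 hr1]
    set k : ℂ → ℝ := fun z => 8 * η * ((1 - ‖(r : ℂ) * w‖ ^ 2) / ‖z - r * w‖ ^ 2)
      + 32 * C / d ^ 3 * (1 - r) with hk
    have hapos {z : ℂ} (hz : ‖z‖ = 1) : 1 - r ≤ ‖z - r * w‖ := by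
      have h := norm_sub_norm_le z (r * w)
      rwa [hrw, hz] at h
    have hpt (z : ℂ) (hz : ‖z‖ = 1) :
        ‖z * (((z - r * w) ^ 2)⁻¹ - ((z - w / r) ^ 2)⁻¹) * H z‖ ≤ k z := by
      rw [norm_mul, norm_mul, hz, one_mul]
      have h1 := norm_reflected_kernel_le hz hw hr0 hr1
      have ha := hapos hz
      have ha0 : 0 < ‖z - r * w‖ := by linarith
      have h2 : ‖z - w‖ ≤ 2 * ‖z - r * w‖ := by
        have h := norm_add_le (z - r * w) (r * w - w)
        have h' : ‖(r : ℂ) * w - w‖ = 1 - r := by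
          have : (r : ℂ) * w - w = ((r - 1 : ℝ) : ℂ) * w := by push_cast; ring
          rw [this, norm_mul, hw, mul_one, Complex.norm_real, Real.norm_eq_abs, abs_sub_comm,
            abs_of_nonneg (by linarith)]
        rw [h', sub_add_sub_cancel] at h
        linarith
      rw [hk]; simp only [hrw]
      have hr2 : 0 ≤ 1 - r ^ 2 := by nlinarith
      by_cases hzd : ‖z - w‖ < d
      · have h3 : ‖H z‖ ≤ η * (2 * ‖z - r * w‖) := by
          have := hnear ⟨by simpa [dist_eq_norm] using hzd, by simpa using hz⟩
          simp only [Set.mem_ofPred_eq] at this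
          exact this.trans (by gcongr)
        calc _ ≤ 4 * (1 - r) / ‖z - r * w‖ ^ 3 * (η * (2 * ‖z - r * w‖)) := by
              gcongr
          _ = 8 * η * ((1 - r) / ‖z - r * w‖ ^ 2) := by field_simp; ring
          _ ≤ 8 * η * ((1 - r ^ 2) / ‖z - r * w‖ ^ 2) := by gcongr; nlinarith
          _ ≤ _ := by
            have : 0 ≤ 32 * C / d ^ 3 * (1 - r) := mul_nonneg (by positivity) (by linarith)
            linarith
      · have h3 : d / 2 ≤ ‖z - r * w‖ := by linarith [not_lt.1 hzd]
        have hr1' : 0 ≤ 1 - r := by linarith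
        calc _ ≤ 4 * (1 - r) / (d / 2) ^ 3 * C := by
              refine mul_le_mul (h1.trans ?_) (hC z (by simpa using hz)) (norm_nonneg _)
                (by positivity)
              gcongr
          _ = 32 * C / d ^ 3 * (1 - r) := by field_simp; ring
          _ ≤ _ := by
            have : 0 ≤ 8 * η * ((1 - r ^ 2) / ‖z - r * w‖ ^ 2) := by positivity
            linarith
    have hpc : ContinuousOn (fun z => (1 - ‖(r : ℂ) * w‖ ^ 2) / ‖z - r * w‖ ^ 2)
        (sphere 0 |1|) := by
      refine ContinuousOn.div (by fun_prop) (by fun_prop) fun z hz => ?_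
      have := hapos (z := z) (by simpa using hz)
      have : 0 < ‖z - r * w‖ := by linarith
      positivity
    have hpi := hpc.circleIntegrable'
    have hki : CircleIntegrable k 0 1 := by
      apply ContinuousOn.circleIntegrable'
      exact (continuousOn_const.mul hpc).add continuousOn_const
    have e : Real.circleAverage k 0 1 = 8 * η + 32 * C / d ^ 3 * (1 - r) := by
      rw [hk, Real.circleAverage_fun_add, Real.circleAverage_const]
      · simp only [← smul_eq_mul (a := 8 * η)]
        rw [Real.circleAverage_fun_smul, circleAverage_poisson_eq_one (by rw [hrw]; exact hr1)]
        simp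
      · apply ContinuousOn.circleIntegrable'
        exact continuousOn_const.mul hpc
      · exact circleIntegrable_const _ _ _
    rw [← e, Real.circleAverage, Real.circleAverage, norm_smul, smul_eq_mul,
      Real.norm_of_nonneg (by positivity)]
    refine mul_le_mul_of_nonneg_left ?_ (by positivity)
    refine intervalIntegral.norm_integral_le_of_norm_le Real.two_pi_pos.le ?_ hki
    refine .of_forall fun t _ => hpt _ ?_
    simp [circleMap]
  rw [Metric.tendsto_nhds]
  intro ε hε
  obtain ⟨B, hB⟩ := main (ε / 16) (by positivity)
  have ht : Tendsto (fun r : ℝ => 8 * (ε / 16) + B * (1 - r)) (𝓝[<] 1) (𝓝 (ε / 2)) := by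
    have : Continuous fun r : ℝ => 8 * (ε / 16) + B * (1 - r) := by fun_prop
    have h := this.tendsto 1
    have e : 8 * (ε / 16) + B * (1 - 1) = ε / 2 := by ring
    rw [e] at h
    exact h.mono_left nhdsWithin_le_nhds
  filter_upwards [ht.eventually_lt_const (half_lt_self hε), Ioo_mem_nhdsLT zero_lt_one]
    with r h1 h2
  rw [dist_zero_right]
  exact (hB r h2.1 h2.2).trans_lt h1

/-- Converts differentiability in the angle into a first-order expansion in `z` along the circle.
There the angle `arg (z / w)` equals `-I log (z / w)`, which has derivative `-I / w` at `w`. -/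
theorem isLittleO_of_hasDerivAt_circle {G : ℂ → ℂ} {t : ℝ} {g' : ℂ}
    (hg : HasDerivAt (fun s : ℝ => G (exp (s * I))) g' t) :
    (fun z => G z - G (exp (t * I)) - (-I / exp (t * I) * g') * (z - exp (t * I)))
      =o[𝓝[sphere 0 1] (exp (t * I))] fun z => z - exp (t * I) := by
  set w := exp (t * I) with hw
  have hw0 : w ≠ 0 := exp_ne_zero _
  have hwn : ‖w‖ = 1 := norm_exp_ofReal_mul_I t
  set ℓ : ℂ → ℂ := fun z => -I * log (z / w) with hℓ
  have hℓd : HasDerivAt ℓ (-I / w) w := by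
    have h1 : HasDerivAt (fun z => z / w) (1 / w) w := (hasDerivAt_id w).div_const w
    have h2 := (h1.clog (by simp [hw0])).const_mul (-I)
    have e : -I * (1 / w / (w / w)) = -I / w := by rw [div_self hw0]; ring
    rwa [e] at h2
  have hℓw : ℓ w = 0 := by simp [hℓ, hw0]
  have hS : ∀ᶠ z in 𝓝[sphere 0 1] w, ‖z‖ = 1 :=
    eventually_nhdsWithin_of_forall fun z hz => by simpa using hz
  have hℓS {z : ℂ} (hz : ‖z‖ = 1) : ((z / w).arg : ℂ) = ℓ z := by
    have : Real.log ‖z / w‖ = 0 := by simp [hz, hwn]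
    rw [hℓ]
    simp only [Complex.log, this, ofReal_zero]
    linear_combination ((z / w).arg : ℂ) * I_sq
  have hexp {z : ℂ} (hz : ‖z‖ = 1) : exp (((t + (z / w).arg : ℝ) : ℂ) * I) = z := by
    have h1 := norm_mul_exp_arg_mul_I (z / w)
    rw [norm_div, hz, hwn] at h1
    push_cast
    rw [add_mul, exp_add, ← hw, ← one_mul (exp ((z / w).arg * I))]
    simp only [div_one, ofReal_one] at h1
    rw [h1]; field_simp
  have hO : (fun z => (z / w).arg) =O[𝓝[sphere 0 1] w] fun z => z - w := by
    have h := (hℓd.isBigO_sub).mono (nhdsWithin_le_nhds (s := sphere 0 1))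
    refine Asymptotics.IsBigO.trans (Asymptotics.IsBigO.of_bound 1 ?_) h
    filter_upwards [hS] with z hz
    rw [hℓw, sub_zero, ← hℓS hz]
    simp
  have htend : Tendsto (fun z => t + (z / w).arg) (𝓝[sphere 0 1] w) (𝓝 t) := by
    have h1 : Tendsto (fun z => (z / w).arg) (𝓝 w) (𝓝 0) := by
      have hc : ContinuousAt (fun z => (z / w).arg) w := by
        refine ContinuousAt.comp (g := arg) (f := fun z => z / w) ?_ (by fun_prop)
        exact continuousAt_arg (by simp [hw0])
      simpa [ContinuousAt, hw0] using hc
    simpa using (h1.const_add t).mono_left nhdsWithin_le_nhds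
  have h1 := (hasDerivAt_iff_isLittleO.1 hg).comp_tendsto htend
  have h3 : ((fun s => s - t) ∘ fun z => t + (z / w).arg) =O[𝓝[sphere 0 1] w] fun z => z - w := by
    simpa [Function.comp_def] using hO
  have h1' := h1.trans_isBigO h3
  have h2 := ((hasDerivAt_iff_isLittleO.1 hℓd).mono
    (nhdsWithin_le_nhds (s := sphere 0 1))).const_mul_left g'
  refine (h1'.add h2).congr' ?_ .rfl
  filter_upwards [hS] with z hz
  simp only [Function.comp_apply, hexp hz, hℓw, ← hℓS hz, add_sub_cancel_left, real_smul,
    smul_eq_mul, ← hw]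
  ring

/-- Fatou's theorem: bounded holomorphic functions on the disc have radial limits a.e. -/
theorem ae_exists_tendsto_radial_of_bounded {f : ℂ → ℂ} (hf : DifferentiableOn ℂ f (ball 0 1))
    {M : ℝ} (hM : ∀ z ∈ ball (0 : ℂ) 1, ‖f z‖ ≤ M) :
    ∀ᵐ t : ℝ, ∃ c, Tendsto (fun r : ℝ => f (r * exp (t * I))) (𝓝[<] 1) (𝓝 c) := by
  -- A primitive of a bounded function is Lipschitz, so it extends to the circle and is
  -- differentiable in the angle almost everywhere.
  obtain ⟨g, hg⟩ := hf.isExactOn_ball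
  have hlip : LipschitzOnWith (Real.toNNReal M) g (ball 0 1) := by
    refine (convex_ball (0 : ℂ) 1).lipschitzOnWith_of_nnnorm_hasDerivWithin_le
      (fun z hz => (hg z hz).hasDerivWithinAt) fun z hz => ?_
    rw [← NNReal.coe_le_coe, coe_nnnorm]
    exact (hM z hz).trans (Real.le_coe_toNNReal M)
  obtain ⟨G, hG, hGg⟩ := hlip.extend_finite_dimension
  have hGd {z : ℂ} (hz : z ∈ ball (0 : ℂ) 1) : HasDerivAt G (f z) z :=
    (hg z hz).congr_of_eventuallyEq
      ((hGg.eventuallyEq_of_mem (isOpen_ball.mem_nhds hz)).symm)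
  have hGc : DiffContOnCl ℂ G (ball 0 1) :=
    ⟨fun z hz => (hGd hz).differentiableAt.differentiableWithinAt, hG.continuous.continuousOn⟩
  have hlipE : LipschitzWith 1 fun s : ℝ => exp (s * I) := by
    refine lipschitzWith_of_nnnorm_deriv_le (by fun_prop) fun s => ?_
    have : HasDerivAt (fun s : ℝ => exp (s * I)) (exp (s * I) * (1 * I)) s :=
      (((hasDerivAt_id (s : ℂ)).mul_const I).cexp).comp_ofReal
    rw [this.deriv, ← NNReal.coe_le_coe]
    simp
  filter_upwards [(hG.comp hlipE).ae_differentiableAt_real] with t ht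
  have ho := isLittleO_of_hasDerivAt_circle (G := G) ht.hasDerivAt
  set w := exp (t * I)
  -- The derivative of the boundary values along the circle. Removing the affine part with slope `c`
  -- leaves a function that is `o(z - w)` there, with derivative `f - c` inside.
  set c := -I / w * deriv (G ∘ fun s : ℝ => exp (s * I)) t
  have hwn : ‖w‖ = 1 := norm_exp_ofReal_mul_I t
  have hHd : DiffContOnCl ℂ (fun z => G z - G w - c * (z - w)) (ball 0 1) :=
    (hGc.sub_const _).sub (Differentiable.diffContOnCl (by fun_prop))
  refine ⟨c, ?_⟩
  have := (tendsto_deriv_radial hHd hwn ho).add_const c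
  rw [zero_add] at this
  refine this.congr' ?_
  filter_upwards [Ioo_mem_nhdsLT zero_lt_one] with r hr
  have hz : (r : ℂ) * w ∈ ball (0 : ℂ) 1 := by simpa [hwn, abs_of_pos hr.1] using hr.2
  have h1 : HasDerivAt (fun z => G z - G w - c * (z - w)) (f (r * w) - c * 1) (r * w) :=
    ((hGd hz).sub_const _).sub (((hasDerivAt_id _).sub_const w).const_mul c)
  rw [h1.deriv]; ring

end Fatou

/-! ### Averaging over translates; measurability of limit sets. -/

section Translate

variable {G : Type*} [Group G] [TopologicalSpace G] [IsTopologicalGroup G] [CompactSpace G]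
  [SecondCountableTopology G] [MeasurableSpace G] [BorelSpace G]
  {T : Type*} [MeasurableSpace T] (ν : Measure T) [IsProbabilityMeasure ν] {θ : T → G}

theorem lintegral_translate (hθ : Measurable θ) {g : G → ℝ≥0∞} (hg : Measurable g) :
    ∫⁻ w, ∫⁻ t, g (θ t * w) ∂ν ∂(normHaar G) = ∫⁻ w, g w ∂(normHaar G) := by
  rw [lintegral_lintegral_swap]
  · simp [lintegral_mul_left_eq_self]
  · exact (hg.comp ((hθ.comp measurable_snd).mul measurable_fst)).aemeasurable

/-- The measure of the complement is the average over `w` of the `ν`-measure of the `t` with `θ t *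
w` outside `E`. Here `ν` need not be Haar measure. -/
theorem ae_of_ae_translate (hθ : Measurable θ) {E : Set G} (hE : MeasurableSet E)
    (h : ∀ᵐ w ∂(normHaar G), ∀ᵐ t ∂ν, θ t * w ∈ E) : ∀ᵐ w ∂(normHaar G), w ∈ E := by
  have h1 := lintegral_translate ν hθ (measurable_one.indicator hE.compl)
  rw [lintegral_indicator_one hE.compl] at h1
  rw [ae_iff]
  refine h1.symm.trans ?_
  rw [lintegral_eq_zero_of_ae_eq_zero]
  filter_upwards [h] with w hw
  refine lintegral_eq_zero_of_ae_eq_zero ?_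
  filter_upwards [hw] with t ht
  simpa using ht

end Translate

/-- Only null sets matter, so averaging over rotations by angles in `(0, 1]` avoids identifying Haar
measure with arc length. -/
theorem ae_circle_of_ae_real {E : Set Circle} (hE : MeasurableSet E)
    (h : ∀ᵐ t : ℝ, Circle.exp t ∈ E) : ∀ᵐ l ∂(normHaar Circle), l ∈ E := by
  have : IsProbabilityMeasure (volume.restrict (Set.Ioc (0 : ℝ) 1)) := ⟨by simp⟩
  refine ae_of_ae_translate (volume.restrict (Set.Ioc (0 : ℝ) 1)) (θ := fun t => Circle.exp t)
    Circle.exp.continuous.measurable hE (.of_forall fun l => ?_)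
  obtain ⟨s, rfl⟩ : ∃ s, Circle.exp s = l := ⟨_, Circle.exp_arg l⟩
  refine ae_restrict_of_ae ?_
  filter_upwards [(measurePreserving_add_right volume s).quasiMeasurePreserving.ae h] with t ht
  rwa [← Circle.exp_add]

theorem measurableSet_exists_tendsto_left {α : Type*} [MeasurableSpace α] {g : ℝ → α → ℂ}
    (hm : ∀ r ∈ Set.Ioo (0 : ℝ) 1, Measurable (g r))
    (hc : ∀ x, ContinuousOn (fun r => g r x) (Set.Ioo 0 1)) :
    MeasurableSet {x | ∃ c, Tendsto (fun r => g r x) (𝓝[<] 1) (𝓝 c)} := by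
  let S := {q : ℚ // (q : ℝ) ∈ Set.Ioo (0 : ℝ) 1}
  let e : S → ℝ := fun q => (q.1 : ℝ)
  have h := MeasureTheory.measurableSet_exists_tendsto (l := comap e (𝓝[<] 1))
    (f := fun q x => g (e q) x) (fun q => hm _ q.2)
  convert h using 4 with x
  ext c
  constructor
  · exact fun h => h.comp tendsto_comap
  · intro h
    rw [Metric.tendsto_nhds] at h ⊢
    intro ε hε
    obtain ⟨u, hu, hq⟩ := h (ε / 2) (half_pos hε)
    obtain ⟨a, ha, hau⟩ := (mem_nhdsLT_iff_exists_Ioo_subset).1 hu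
    have ha : a < 1 := ha
    filter_upwards [Ioo_mem_nhdsLT (max_lt ha zero_lt_one)] with r hr
    by_contra hcon
    have hr01 : r ∈ Set.Ioo (0 : ℝ) 1 := ⟨(le_max_right _ _).trans_lt hr.1, hr.2⟩
    have hcont : ContinuousAt (fun r => dist (g r x) c) r :=
      ((hc x).continuousAt (isOpen_Ioo.mem_nhds hr01)).dist continuousAt_const
    -- Distance greater than `ε / 2` is an open condition on the radius, so a bad radius has a bad
    -- rational one nearby.
    have hev : ∀ᶠ y in 𝓝 r, ε / 2 < dist (g y x) c ∧ y ∈ Set.Ioo (max a 0) 1 :=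
      (hcont.eventually_const_lt (by linarith [not_lt.1 hcon])).and (isOpen_Ioo.mem_nhds hr)
    obtain ⟨v, hv, hvo, hrv⟩ := eventually_nhds_iff.1 hev
    obtain ⟨q, hqv⟩ := Rat.denseRange_cast.exists_mem_open hvo ⟨r, hrv⟩
    have h1 := hv _ hqv
    have h2 : (q : ℝ) ∈ Set.Ioo (0 : ℝ) 1 := ⟨(le_max_right _ _).trans_lt h1.2.1, h1.2.2⟩
    have h3 := hq (a := ⟨q, h2⟩) (hau ⟨(le_max_left _ _).trans_lt h1.2.1, h1.2.2⟩)
    exact lt_asymm h1.1 h3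

/-! ### Montel's theorem and the Nevanlinna class of the disc. -/

section Disc

open Metric

theorem exists_tendsto_ultrafilter_of_norm_le {ι : Type*} (U : Ultrafilter ι) {x : ι → ℂ} {M : ℝ}
    (h : ∀ i, ‖x i‖ ≤ M) : ∃ c, Tendsto x U (𝓝 c) := by
  obtain ⟨c, -, hc⟩ := (isCompact_closedBall (0 : ℂ) M).ultrafilter_le_nhds (U.map x) (by
    rw [Ultrafilter.coe_map, le_principal_iff, mem_map]
    exact univ_mem' fun i => by simpa using h i)
  exact ⟨c, hc⟩

/-- Schwarz's lemma for `f`, then for its difference quotient. The constants depend on `R` alone, so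
the bounds survive pointwise limits. -/
theorem norm_sub_sub_le_of_norm_le_one {f : ℂ → ℂ} {z : ℂ} {R : ℝ} (hR : 0 < R)
    (hf : DifferentiableOn ℂ f (ball z R)) (hb : ∀ y ∈ ball z R, ‖f y‖ ≤ 1) :
    ‖deriv f z‖ ≤ 2 / R ∧
    ∀ y ∈ ball z R, ‖f y - f z - (y - z) • deriv f z‖ ≤ 4 / R / R * ‖y - z‖ ^ 2 := by
  have hz := mem_ball_self hR (x := z)
  have hmaps : Set.MapsTo f (ball z R) (closedBall (f z) 2) := fun y hy => by
    rw [mem_closedBall, dist_eq_norm]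
    exact (norm_sub_le _ _).trans (by linarith [hb y hy, hb z hz])
  have h1 {y : ℂ} (hy : y ∈ ball z R) : ‖dslope f z y‖ ≤ 2 / R :=
    Complex.norm_dslope_le_div_of_mapsTo_ball hf hmaps hy
  have h2 : DifferentiableOn ℂ (dslope f z) (ball z R) :=
    (Complex.differentiableOn_dslope (isOpen_ball.mem_nhds hz)).2 hf
  have hmaps2 : Set.MapsTo (dslope f z) (ball z R) (closedBall (dslope f z z) (4 / R)) :=
    fun y hy => by
      rw [mem_closedBall, dist_eq_norm]
      refine (norm_sub_le _ _).trans ((add_le_add (h1 hy) (h1 hz)).trans (le_of_eq ?_))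
      ring
  refine ⟨by simpa using h1 hz, fun y hy => ?_⟩
  have h3 := Complex.dist_le_div_mul_dist_of_mapsTo_ball h2 hmaps2 hy
  rw [dslope_same, dist_eq_norm, dist_eq_norm] at h3
  have h4 : f y - f z - (y - z) • deriv f z = (y - z) • (dslope f z y - deriv f z) := by
    rw [smul_sub, sub_smul_dslope]
  rw [h4, norm_smul, sq]
  nlinarith [mul_le_mul_of_nonneg_left h3 (norm_nonneg (y - z))]

/-- Montel's theorem, as existence of limits along ultrafilters. -/
theorem exists_differentiableOn_tendsto_ultrafilter {ι : Type*} (U : Ultrafilter ι)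
    {φ : ι → ℂ → ℂ} (hd : ∀ i, DifferentiableOn ℂ (φ i) (ball 0 1))
    (hb : ∀ i, ∀ z ∈ ball (0 : ℂ) 1, ‖φ i z‖ ≤ 1) :
    ∃ g : ℂ → ℂ, DifferentiableOn ℂ g (ball 0 1) ∧
      ∀ z ∈ ball (0 : ℂ) 1, Tendsto (fun i => φ i z) U (𝓝 (g z)) := by
  have h1 (z : ℂ) : ∃ c, z ∈ ball (0 : ℂ) 1 → Tendsto (fun i => φ i z) U (𝓝 c) := by
    by_cases hz : z ∈ ball (0 : ℂ) 1
    · obtain ⟨c, hc⟩ := exists_tendsto_ultrafilter_of_norm_le U fun i => hb i z hz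
      exact ⟨c, fun _ => hc⟩
    · exact ⟨0, fun h => absurd h hz⟩
  choose g hg using h1
  refine ⟨g, fun z hz => DifferentiableAt.differentiableWithinAt ?_, hg⟩
  obtain ⟨R, hR, hRs⟩ := Metric.isOpen_iff.1 isOpen_ball z hz
  have h2 (i : ι) := norm_sub_sub_le_of_norm_le_one hR ((hd i).mono hRs) fun y hy => hb i y (hRs hy)
  obtain ⟨d, hdlim⟩ := exists_tendsto_ultrafilter_of_norm_le U fun i => (h2 i).1
  have h3 : ∀ y ∈ ball z R, ‖g y - g z - (y - z) • d‖ ≤ 4 / R / R * ‖y - z‖ ^ 2 := by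
    intro y hy
    have ht : Tendsto (fun i => ‖φ i y - φ i z - (y - z) • deriv (φ i) z‖) U
        (𝓝 ‖g y - g z - (y - z) • d‖) :=
      (((hg y (hRs hy)).sub (hg z hz)).sub (hdlim.const_smul _)).norm
    exact le_of_tendsto ht (.of_forall fun i => (h2 i).2 y hy)
  have h4 : HasDerivAt g d z := by
    rw [hasDerivAt_iff_isLittleO]
    refine Asymptotics.IsBigO.trans_isLittleO (g := fun y => ‖y - z‖ ^ 2) ?_ ?_
    · refine Asymptotics.IsBigO.of_bound (4 / R / R) ?_
      filter_upwards [isOpen_ball.mem_nhds (mem_ball_self hR)] with y hy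
      simpa using h3 y hy
    · have := (Asymptotics.isLittleO_pow_sub_sub z (one_lt_two)).norm_left
      simpa using this
  exact h4.differentiableAt

theorem diffContOnCl_comp_mul {f : ℂ → ℂ} (hf : DifferentiableOn ℂ f (ball 0 1)) {r : ℂ}
    (hr : ‖r‖ < 1) : DiffContOnCl ℂ (fun z => f (r * z)) (ball 0 1) := by
  refine DifferentiableOn.diffContOnCl (hf.comp (by fun_prop) fun z hz => ?_)
  rw [closure_ball _ one_ne_zero, mem_closedBall_zero_iff] at hz
  rw [mem_ball_zero_iff, norm_mul]
  nlinarith [norm_nonneg r, norm_nonneg z]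

/-- The radii `1 - 1 / (n + 2)`. -/
def radius (n : ℕ) : ℝ := 1 - 1 / (n + 2)

theorem radius_mem (n : ℕ) : radius n ∈ Set.Ioo (0 : ℝ) 1 := by
  have : (0 : ℝ) < n + 2 := by positivity
  rw [radius, Set.mem_Ioo, sub_pos, div_lt_one this, sub_lt_self_iff]
  exact ⟨by linarith [n.cast_nonneg (α := ℝ)], by positivity⟩

theorem tendsto_radius : Tendsto radius atTop (𝓝[<] 1) := by
  refine tendsto_nhdsWithin_iff.2 ⟨?_, .of_forall fun n => (radius_mem n).2⟩
  have h : Tendsto (fun n : ℕ => 1 / ((n : ℝ) + 2)) atTop (𝓝 0) := by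
    simp only [one_div]
    exact tendsto_inv_atTop_zero.comp (tendsto_atTop_add_const_right _ _ tendsto_natCast_atTop_atTop)
  have h2 := h.const_sub 1
  rw [sub_zero] at h2
  exact h2

theorem norm_radius_lt_one (n : ℕ) : ‖(radius n : ℂ)‖ < 1 := by
  simpa [abs_of_pos (radius_mem n).1] using (radius_mem n).2

/-- A function of the Nevanlinna class is a quotient of bounded functions. -/
theorem NevanlinnaDisc.exists_bounded_mul {f : ℂ → ℂ} (hf : NevanlinnaDisc f) :
    ∃ g : ℂ → ℂ, DifferentiableOn ℂ g (ball 0 1) ∧ (∀ z ∈ ball (0 : ℂ) 1, ‖g z‖ ≤ 1) ∧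
      (∀ z ∈ ball (0 : ℂ) 1, ‖f z * g z‖ ≤ 1) ∧ g 0 ≠ 0 := by
  obtain ⟨hd, hC⟩ := hf
  set C := ⨆ r ∈ Set.Ioo (0 : ℝ) 1,
    ∫⁻ l : Circle, ENNReal.ofReal (Real.posLog ‖f ((r : ℂ) * (l : ℂ))‖) ∂(normHaar Circle) with hCdef
  have hfn (n : ℕ) : DiffContOnCl ℂ (fun z => f (radius n * z)) (ball 0 1) :=
    diffContOnCl_comp_mul hd (norm_radius_lt_one n)
  -- `exp (-p n)` and its product with `f (radius n * z)` are bounded by 1. The mean of `log⁺`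
  -- bounds `Re (p n) 0`, which keeps the limit nonzero at 0.
  choose p hp1 hp2 using fun n => exists_polynomial_majorant (hfn n) one_pos one_pos
  have hp0 (n : ℕ) : ((p n).eval 0).re ≤ C.toReal + 1 := by
    have hc := continuous_posLog_norm (hfn n).continuous_circle_one
    rw [← integral_polynomial_re_circle _ 1]
    calc _ ≤ ∫ l : Circle, (Real.posLog ‖f (radius n * l)‖ + 1) ∂(normHaar Circle) := by
          refine integral_mono (integrable_of_continuous (by fun_prop))
            (integrable_of_continuous (by fun_prop)) fun l => ?_
          simpa [Real.posLog_eq_log_max_one, max_comm] using hp1 n l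
      _ = ∫ l : Circle, Real.posLog ‖f (radius n * l)‖ ∂(normHaar Circle) + 1 := by
          rw [integral_add (integrable_of_continuous hc) (integrable_const _)]; simp
      _ ≤ _ := by
          gcongr
          rw [← ENNReal.ofReal_le_iff_le_toReal hC.ne,
            ofReal_integral_circle hc fun _ => Real.posLog_nonneg]
          exact le_iSup₂ (f := fun (r : ℝ) (_ : r ∈ Set.Ioo (0 : ℝ) 1) => ∫⁻ l : Circle,
            ENNReal.ofReal (Real.posLog ‖f ((r : ℂ) * (l : ℂ))‖) ∂(normHaar Circle))
            (radius n) (radius_mem n)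
  have hmaj (n : ℕ) {z : ℂ} (hz : z ∈ ball (0 : ℂ) 1) :
      max ‖f (radius n * z)‖ 1 ≤ Real.exp ((p n).eval z).re := by
    rw [← Real.log_le_iff_le_exp (by positivity)]
    exact hp2 n z (ball_subset_closedBall hz)
  have hb (n : ℕ) (z : ℂ) (hz : z ∈ ball (0 : ℂ) 1) : ‖Complex.exp (-(p n).eval z)‖ ≤ 1 := by
    rw [Complex.norm_exp, Complex.neg_re, Real.exp_neg, inv_le_one₀ (Real.exp_pos _)]
    exact (le_max_right _ _).trans (hmaj n hz)
  obtain ⟨g, hgd, hg⟩ := exists_differentiableOn_tendsto_ultrafilter (hyperfilter ℕ)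
    (φ := fun n z => Complex.exp (-(p n).eval z)) (fun n => by fun_prop) hb
  refine ⟨g, hgd, fun z hz => le_of_tendsto (hg z hz).norm (.of_forall fun n => hb n z hz),
    fun z hz => ?_, ?_⟩
  · have h1 : Tendsto (fun n => f (radius n * z)) (hyperfilter ℕ : Filter ℕ) (𝓝 (f z)) := by
      refine Tendsto.mono_left ?_ (Nat.hyperfilter_le_atTop)
      have h2 : Tendsto (fun n => (radius n : ℂ) * z) atTop (𝓝 z) := by
        have h3 := (tendsto_radius.mono_right nhdsWithin_le_nhds)
        simpa using ((Complex.continuous_ofReal.tendsto _).comp h3).mul_const z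
      exact (hd.continuousOn.continuousAt (isOpen_ball.mem_nhds hz)).tendsto.comp h2
    refine le_of_tendsto (h1.mul (hg z hz)).norm (.of_forall fun n => ?_)
    rw [norm_mul, Complex.norm_exp, Complex.neg_re, Real.exp_neg, ← div_eq_mul_inv,
      div_le_one (Real.exp_pos _)]
    exact (le_max_left _ _).trans (hmaj n hz)
  · have h1 : Real.exp (-(C.toReal + 1)) ≤ ‖g 0‖ := by
      refine ge_of_tendsto (hg 0 (by simp)).norm (.of_forall fun n => ?_)
      rw [Complex.norm_exp, Complex.neg_re]
      exact Real.exp_le_exp.2 (neg_le_neg (hp0 n))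
    exact norm_pos_iff.1 ((Real.exp_pos _).trans_le h1)

theorem measurableSet_radialLimit_disc {f : ℂ → ℂ} (hf : ContinuousOn f (ball 0 1)) :
    MeasurableSet {l : Circle | ∃ c, Tendsto (fun r : ℝ => f (r * l)) (𝓝[<] 1) (𝓝 c)} := by
  have hmem {r : ℝ} (hr : r ∈ Set.Ioo (0 : ℝ) 1) (l : Circle) : (r : ℂ) * l ∈ ball (0 : ℂ) 1 := by
    simpa [abs_of_pos hr.1, Circle.norm_coe] using hr.2
  refine measurableSet_exists_tendsto_left (g := fun r (l : Circle) => f (r * l))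
    (fun r hr => ?_) fun l => ?_
  · exact (hf.comp_continuous (by fun_prop) (hmem hr)).measurable
  · exact hf.comp (by fun_prop) fun r hr => hmem hr l

theorem ae_circle_radialLimit_of_bounded {f : ℂ → ℂ} (hf : DifferentiableOn ℂ f (ball 0 1))
    {M : ℝ} (hM : ∀ z ∈ ball (0 : ℂ) 1, ‖f z‖ ≤ M) :
    ∀ᵐ l : Circle ∂(normHaar Circle), ∃ c, Tendsto (fun r : ℝ => f (r * (l : ℂ))) (𝓝[<] 1) (𝓝 c) := by
  refine ae_circle_of_ae_real (measurableSet_radialLimit_disc hf.continuousOn) ?_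
  filter_upwards [ae_exists_tendsto_radial_of_bounded hf hM] with t ⟨c, hc⟩
  exact ⟨c, by simpa [Circle.coe_exp] using hc⟩

/-- Functions of the Nevanlinna class of the disc have radial limits almost everywhere. -/
theorem NevanlinnaDisc.ae_radialLimit {f : ℂ → ℂ} (hf : NevanlinnaDisc f) :
    ∀ᵐ l : Circle ∂(normHaar Circle), ∃ c, Tendsto (fun r : ℝ => f (r * (l : ℂ))) (𝓝[<] 1) (𝓝 c) := by
  obtain ⟨g, hgd, hg1, hfg, hg0⟩ := hf.exists_bounded_mul
  have hgn (n : ℕ) : DiffContOnCl ℂ (fun z => g (radius n * z)) (ball 0 1) :=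
    diffContOnCl_comp_mul hgd (norm_radius_lt_one n)
  have hmeas (n : ℕ) : Measurable fun l : Circle => negLog (g (radius n * l)) :=
    measurable_negLog.comp (hgn n).continuous_circle_one.measurable
  have hint (n : ℕ) : ∫⁻ l : Circle, negLog (g (radius n * l)) ∂(normHaar Circle)
      ≤ negLog (g 0) := by
    -- Jensen's inequality from the centre, where `g` is nonzero; `log⁺ ‖g‖` vanishes.
    have h := lintegral_negLog_le (hgn n) (s := 0) (by simp)
    have h0 (l : Circle) : Real.posLog ‖g (radius n * l)‖ = 0 := by
      rw [Real.posLog_eq_zero_iff, abs_of_nonneg (norm_nonneg _)]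
      refine hg1 _ ?_
      simpa [Circle.norm_coe] using norm_radius_lt_one n
    simpa [h0] using h
  have hfin : ∀ᵐ l : Circle ∂(normHaar Circle),
      liminf (fun n => negLog (g (radius n * l))) atTop < ∞ := by
    refine ae_lt_top (.liminf hmeas) (ne_of_lt ?_)
    refine (lintegral_liminf_le hmeas).trans_lt (lt_of_le_of_lt ?_ (negLog_lt_top hg0))
    refine liminf_le_of_frequently_le' (.of_forall hint)
  filter_upwards [ae_circle_radialLimit_of_bounded hgd hg1,
    ae_circle_radialLimit_of_bounded (hf.1.mul hgd) hfg, hfin] with l ⟨c, hc⟩ ⟨d, hd⟩ hl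
  -- A zero limit would make the liminf of `negLog` infinite. With `c ≠ 0`, `f` is recovered as `(f
  -- g) / g`.
  have hc0 : c ≠ 0 := by
    rintro rfl
    have h := negLog_le_liminf (hc.comp tendsto_radius)
    rw [negLog_zero] at h
    exact absurd (h.trans_lt hl) (lt_irrefl _)
  refine ⟨d / c, (hd.div hc hc0).congr' ?_⟩
  filter_upwards [hc.eventually_ne hc0] with r hr
  simp [hr]

end Disc

/-! ### Holomorphic functions on Banach spaces. -/

section Holomorphic

open Metric

variable {X : Type*} [NormedAddCommGroup X] [NormedSpace ℂ X] {F : X → ℂ} {V : Set X}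

theorem HolomorphicOn.exists_lipschitzOn_ball (hF : HolomorphicOn F V) (hV : IsOpen V) {x : X}
    (hx : x ∈ V) : ∃ K : ℝ, ∃ R > 0, ball x R ⊆ V ∧
      ∀ y ∈ ball x R, ∀ y' ∈ ball x R, ‖F y' - F y‖ ≤ K * ‖y' - y‖ := by
  obtain ⟨U, hU, C, hC⟩ := hF.1 x hx
  obtain ⟨R, hR, hRs⟩ := Metric.mem_nhds_iff.1 (inter_mem hU (hV.mem_nhds hx))
  have hC' {y : X} (hy : y ∈ ball x R) : ‖F y‖ ≤ C := hC y (hRs hy)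
  have hsub : ball x (R / 3) ⊆ ball x R := ball_subset_ball (by linarith)
  refine ⟨3 * C / R, R / 3, by positivity, fun y hy => (hRs (hsub hy)).2, fun y hy y' hy' => ?_⟩
  rcases eq_or_ne y' y with rfl | hne
  · simp
  have hv : 0 < ‖y' - y‖ := norm_pos_iff.2 (sub_ne_zero.2 hne)
  have hv2 : ‖y' - y‖ < 2 * R / 3 := by
    rw [← dist_eq_norm]
    linarith [dist_triangle_right y' y x, mem_ball.1 hy, mem_ball.1 hy']
  -- For `‖z‖ < S` the line through `y` and `y'` stays in the ball of radius `R`; Schwarz's lemma on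
  -- this disc, evaluated at `z = 1`, gives the Lipschitz bound.
  set S := 2 * R / 3 / ‖y' - y‖ with hS
  have hS1 : 1 < S := by rwa [hS, one_lt_div hv]
  have hin {z : ℂ} (hz : z ∈ ball (0 : ℂ) S) : y + z • (y' - y) ∈ ball x R := by
    rw [mem_ball_zero_iff, hS, lt_div_iff₀ hv] at hz
    rw [mem_ball, dist_eq_norm] at hy ⊢
    have h1 : y + z • (y' - y) - x = (y - x) + z • (y' - y) := by abel
    rw [h1]
    refine (norm_add_le _ _).trans_lt ?_
    rw [norm_smul]
    linarith
  have hd : DifferentiableOn ℂ (fun z : ℂ => F (y + z • (y' - y))) (ball 0 S) :=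
    (hF.2 y (hRs (hsub hy)).2 (y' - y)).mono fun z hz => (hRs (hin hz)).2
  have hm : Set.MapsTo (fun z : ℂ => F (y + z • (y' - y))) (ball 0 S)
      (closedBall ((fun z : ℂ => F (y + z • (y' - y))) 0) (2 * C)) := by
    intro z hz
    rw [mem_closedBall, dist_eq_norm]
    refine (norm_sub_le _ _).trans ?_
    have h0 : (0 : ℂ) ∈ ball (0 : ℂ) S := mem_ball_self (by linarith)
    linarith [hC' (hin hz), hC' (hin h0)]
  have h := Complex.dist_le_div_mul_dist_of_mapsTo_ball hd hm (z := 1) (by simpa using hS1)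
  simp only [one_smul, add_sub_cancel, zero_smul, add_zero, dist_eq_norm, sub_zero, norm_one,
    mul_one] at h
  refine h.trans (le_of_eq ?_)
  rw [hS]; field_simp

theorem HolomorphicOn.continuousAt (hF : HolomorphicOn F V) (hV : IsOpen V) {x : X}
    (hx : x ∈ V) : ContinuousAt F x := by
  obtain ⟨K, R, hR, -, hK⟩ := hF.exists_lipschitzOn_ball hV hx
  rw [ContinuousAt, tendsto_iff_norm_sub_tendsto_zero]
  have h : Tendsto (fun y => K * ‖y - x‖) (𝓝 x) (𝓝 0) := by
    have : Continuous fun y : X => K * ‖y - x‖ := by fun_prop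
    simpa using this.tendsto x
  refine squeeze_zero' (.of_forall fun _ => norm_nonneg _) ?_ h
  filter_upwards [ball_mem_nhds x hR] with y hy using hK x (mem_ball_self hR) y hy

/-- The chain rule for a holomorphic function along a holomorphic curve. -/
theorem HolomorphicOn.differentiableAt_comp (hF : HolomorphicOn F V) (hV : IsOpen V) {γ : ℂ → X}
    {z : ℂ} (hγ : DifferentiableAt ℂ γ z) (hz : γ z ∈ V) :
    DifferentiableAt ℂ (fun y => F (γ y)) z := by
  obtain ⟨K, R, hR, hRV, hK⟩ := hF.exists_lipschitzOn_ball hV hz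
  set x := deriv γ z
  have hγ' : HasDerivAt γ x z := hγ.hasDerivAt
  have hc : Continuous fun y : ℂ => γ z + (y - z) • x := by fun_prop
  have hline : DifferentiableAt ℂ (fun y : ℂ => F (γ z + (y - z) • x)) z := by
    have h1 : DifferentiableAt ℂ (fun y : ℂ => F (γ z + y • x)) (z - z) := by
      refine (hF.2 (γ z) hz x).differentiableAt (IsOpen.mem_nhds ?_ (by simpa using hz))
      exact hV.preimage (by fun_prop)
    exact h1.comp (f := fun y : ℂ => y - z) z (by fun_prop)
  have hlo : (fun y => γ y - (γ z + (y - z) • x)) =o[𝓝 z] fun y => y - z := by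
    simpa [sub_sub] using hasDerivAt_iff_isLittleO.1 hγ'
  -- The Lipschitz bound lets the curve be replaced by its tangent line, along which `F` is
  -- holomorphic by definition.
  have hFo : (fun y => F (γ y) - F (γ z + (y - z) • x)) =o[𝓝 z] fun y => y - z := by
    refine Asymptotics.IsBigO.trans_isLittleO (.of_bound K ?_) hlo
    have e2 : ∀ᶠ y in 𝓝 z, γ z + (y - z) • x ∈ ball (γ z) R :=
      hc.continuousAt.eventually_mem (by simpa using ball_mem_nhds (γ z) hR)
    filter_upwards [hγ.continuousAt.eventually_mem (ball_mem_nhds _ hR), e2] with y h1 h2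
    exact hK _ h2 _ h1
  refine HasDerivAt.differentiableAt
    (f' := deriv (fun y : ℂ => F (γ z + (y - z) • x)) z) ?_
  have h2 := hasDerivAt_iff_isLittleO.1 hline.hasDerivAt
  rw [hasDerivAt_iff_isLittleO]
  refine (hFo.add h2).congr_left fun y => ?_
  simp only [sub_self, zero_smul, add_zero, smul_eq_mul]
  ring

end Holomorphic

/-! ### The domain in `ℓ¹`, slices and dilations. -/

theorem isOpen_discOne : IsOpen discOne := by
  rw [Metric.isOpen_iff]
  intro ζ hζ
  have hsum : Summable fun n => ‖ζ n‖ := by simpa using (lp.memℓp ζ).summable (by simp)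
  have hfin : {n | ¬ ‖ζ n‖ < 1 / 2}.Finite :=
    (hsum.tendsto_cofinite_zero.eventually_lt_const (by norm_num : (0 : ℝ) < 1 / 2))
  -- Only finitely many coordinates reach `1 / 2`, so the moduli stay uniformly below 1.
  obtain ⟨δ, hδ, hδn⟩ : ∃ δ > 0, ∀ n, ‖ζ n‖ + δ ≤ 1 := by
    obtain ⟨s, hs1, hs⟩ : ∃ s < 1, ∀ n ∈ hfin.toFinset, ‖ζ n‖ ≤ s := by
      rcases hfin.toFinset.eq_empty_or_nonempty with h | h
      · exact ⟨0, one_pos, by rw [h]; simp⟩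
      · obtain ⟨m, -, hm⟩ := hfin.toFinset.exists_max_image (fun n => ‖ζ n‖) h
        exact ⟨‖ζ m‖, hζ m, hm⟩
    refine ⟨min (1 / 2) (1 - s), lt_min (by norm_num) (by linarith), fun n => ?_⟩
    by_cases hn : ‖ζ n‖ < 1 / 2
    · linarith [min_le_left (1 / 2) (1 - s)]
    · linarith [min_le_right (1 / 2) (1 - s), hs n (by simpa using hn)]
  refine ⟨δ, hδ, fun ξ hξ n => ?_⟩
  have h1 := lp.norm_apply_le_norm one_ne_zero (ξ - ζ) n
  rw [Metric.mem_ball, dist_eq_norm] at hξ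
  have h2 : ξ n = ζ n + (ξ - ζ) n := by simp
  rw [h2]
  exact (norm_add_le _ _).trans_lt (by linarith [hδn n])

/-- The point of `ℓ¹` with given coordinates. -/
def ofSeq (a : ℕ → ℂ) : EllOne := ∑' n, lp.singleContinuousLinearMap ℂ (fun _ => ℂ) 1 n (a n)

theorem hasSum_ofSeq_coe (ζ : EllOne) :
    HasSum (fun n => lp.singleContinuousLinearMap ℂ (fun _ => ℂ) 1 n (ζ n)) ζ :=
  lp.hasSum_single ENNReal.one_ne_top ζ

theorem ofSeq_coe (ζ : EllOne) : ofSeq ζ = ζ := (hasSum_ofSeq_coe ζ).tsum_eq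

theorem norm_single (n : ℕ) (c : ℂ) :
    ‖lp.singleContinuousLinearMap ℂ (fun _ => ℂ) 1 n c‖ = ‖c‖ :=
  lp.norm_single (E := fun _ : ℕ => ℂ) (p := 1) one_pos n c

theorem memℓp_one {a : ℕ → ℂ} (ha : Summable fun n => ‖a n‖) : Memℓp a 1 :=
  memℓp_gen (by simpa using ha)

theorem ofSeq_eq_mk {a : ℕ → ℂ} (ha : Memℓp a 1) : ofSeq a = (⟨a, ha⟩ : EllOne) :=
  ofSeq_coe (⟨a, ha⟩ : EllOne)

theorem ofSeq_apply {a : ℕ → ℂ} (ha : Summable fun n => ‖a n‖) (n : ℕ) : ofSeq a n = a n := by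
  rw [ofSeq_eq_mk (memℓp_one ha)]

theorem ofSeq_add_smul {a b : ℕ → ℂ} (ha : Summable fun n => ‖a n‖)
    (hb : Summable fun n => ‖b n‖) (z : ℂ) :
    ofSeq (fun n => a n + z * b n) = ofSeq a + z • ofSeq b := by
  have hab : Summable fun n => ‖a n + z * b n‖ :=
    Summable.of_nonneg_of_le (fun _ => norm_nonneg _) (fun n => norm_add_le _ _)
      (ha.add (by simpa using hb.mul_left ‖z‖))
  ext n
  rw [ofSeq_apply hab, lp.coeFn_add, Pi.add_apply, lp.coeFn_smul, Pi.smul_apply, ofSeq_apply ha,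
    ofSeq_apply hb, smul_eq_mul]

theorem starPoint_eq_ofSeq {z : ℂ} (hz : ‖z‖ < 1) (w : InfTorus) :
    starPoint z w = ofSeq fun n => z ^ (n + 1) * (w n : ℂ) := by
  rw [starPoint, dif_pos (memlp_starPoint hz w), ofSeq_eq_mk (memlp_starPoint hz w)]

theorem continuousOn_ofSeq {α : Type*} [TopologicalSpace α] {s : Set α} {a : α → ℕ → ℂ}
    (ha : ∀ n, ContinuousOn (fun x => a x n) s) {u : ℕ → ℝ} (hu : Summable u)
    (hau : ∀ n, ∀ x ∈ s, ‖a x n‖ ≤ u n) : ContinuousOn (fun x => ofSeq (a x)) s :=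
  continuousOn_tsum (fun n => (ContinuousLinearMap.continuous _).comp_continuousOn (ha n)) hu
    fun n x hx => by rw [norm_single]; exact hau n x hx

theorem summable_pow_succ {r : ℝ} (h0 : 0 ≤ r) (h1 : r < 1) : Summable fun n : ℕ => r ^ (n + 1) :=
  (summable_nat_add_iff 1).2 (summable_geometric_of_lt_one h0 h1)

theorem differentiableAt_starPoint {z : ℂ} (hz : ‖z‖ < 1) (w : InfTorus) :
    DifferentiableAt ℂ (fun y => starPoint y w) z := by
  obtain ⟨ρ, hzρ, hρ⟩ := exists_between hz
  have hρ0 : 0 ≤ ρ := (norm_nonneg z).trans hzρ.le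
  have hmem : Metric.ball (0 : ℂ) ρ ∈ 𝓝 z := Metric.isOpen_ball.mem_nhds (by simpa using hzρ)
  have h : DifferentiableOn ℂ (fun y : ℂ => ofSeq fun n => y ^ (n + 1) * (w n : ℂ))
      (Metric.ball 0 ρ) := by
    refine Complex.differentiableOn_tsum_of_summable_norm (summable_pow_succ hρ0 hρ) (fun n => ?_)
      Metric.isOpen_ball fun n y hy => ?_
    · exact (ContinuousLinearMap.differentiable _).comp_differentiableOn (by fun_prop)
    · rw [norm_single, norm_mul, Circle.norm_coe, mul_one, norm_pow]
      have : ‖y‖ < ρ := by simpa using hy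
      gcongr
  refine (h.differentiableAt hmem).congr_of_eventuallyEq ?_
  filter_upwards [hmem] with y hy
  exact starPoint_eq_ofSeq ((by simpa using hy : ‖y‖ < ρ).trans hρ) w

variable {F : EllOne → ℂ}

theorem HolomorphicOn.continuousOn_discOne (hF : HolomorphicOn F discOne) :
    ContinuousOn F discOne :=
  fun _ hx => (hF.continuousAt isOpen_discOne hx).continuousWithinAt

theorem HolomorphicOn.differentiableOn_slice (hF : HolomorphicOn F discOne) (w : InfTorus) :
    DifferentiableOn ℂ (slice F w) (Metric.ball 0 1) := by
  intro z hz
  have hz : ‖z‖ < 1 := by simpa using hz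
  exact (hF.differentiableAt_comp isOpen_discOne (differentiableAt_starPoint hz w)
    (starPoint_mem_discOne hz w)).differentiableWithinAt

theorem HolomorphicOn.continuous_dilation (hF : HolomorphicOn F discOne) {r : ℝ}
    (hr : r ∈ Set.Ioo (0 : ℝ) 1) : Continuous (dilation F r) := by
  have hr' : ‖(r : ℂ)‖ < 1 := by simpa [abs_of_pos hr.1] using hr.2
  refine hF.continuousOn_discOne.comp_continuous ?_ (fun w => starPoint_mem_discOne hr' w)
  rw [← continuousOn_univ, show starPoint r = fun w => ofSeq fun n => (r : ℂ) ^ (n + 1) * (w n : ℂ)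
    from funext (starPoint_eq_ofSeq hr')]
  refine continuousOn_ofSeq (fun n => Continuous.continuousOn (by fun_prop))
    (summable_pow_succ hr.1.le hr.2) fun n w _ => ?_
  simp [Circle.norm_coe, abs_of_pos hr.1]

theorem HolomorphicOn.continuousOn_dilation (hF : HolomorphicOn F discOne) (w : InfTorus) :
    ContinuousOn (fun r => dilation F r w) (Set.Ioo 0 1) := by
  refine (hF.differentiableOn_slice w).continuousOn.comp (f := fun r : ℝ => (r : ℂ))
    (by fun_prop) fun r hr => ?_
  simpa [abs_of_pos hr.1] using hr.2

/-- The rotation `λ ↦ (λ, λ², λ³, …)`. -/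
def powers (l : Circle) : InfTorus := fun n => l ^ (n + 1)

theorem measurable_powers : Measurable powers :=
  (continuous_pi fun n => continuous_pow (n + 1)).measurable

theorem slice_mul_circle (F : EllOne → ℂ) (w : InfTorus) {r : ℝ} (hr : r ∈ Set.Ioo (0 : ℝ) 1)
    (l : Circle) : slice F w (r * l) = dilation F r (powers l * w) := by
  have hr' : ‖(r : ℂ)‖ < 1 := by simpa [abs_of_pos hr.1] using hr.2
  have h : (fun n : ℕ => ((r : ℂ) * l) ^ (n + 1) * (w n : ℂ))
      = fun n : ℕ => (r : ℂ) ^ (n + 1) * (((powers l * w) n : Circle) : ℂ) := by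
    ext n; simp [powers, mul_pow, mul_assoc]
  rw [slice, dilation, starPoint_eq_ofSeq (by simpa [Circle.norm_coe] using hr'),
    starPoint_eq_ofSeq hr', h]

/-! ### Harnack's inequality on the polydisc; one radius with integrable logarithm. -/

/-- The closed polydisc. -/
def polydisc : Set (ℕ → ℂ) := Set.univ.pi fun _ => Metric.closedBall 0 1

theorem mem_polydisc {c : ℕ → ℂ} : c ∈ polydisc ↔ ∀ n, ‖c n‖ ≤ 1 := by simp [polydisc]

theorem isCompact_polydisc : IsCompact polydisc :=
  isCompact_univ_pi fun _ => isCompact_closedBall 0 1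

section Polydisc

variable {G : (ℕ → ℂ) → ℂ} (hGc : ContinuousOn G polydisc)
  (hGd : ∀ c d : ℕ → ℂ, (∀ z ∈ Metric.closedBall (0 : ℂ) 1, (fun n => c n + z * d n) ∈ polydisc) →
    DifferentiableOn ℂ (fun z : ℂ => G fun n => c n + z * d n) (Metric.closedBall 0 1))
  (hG1 : ∀ c ∈ polydisc, ‖G c‖ ≤ 1)

include hGc hGd hG1

/-- Rotating the coordinates in `S` simultaneously, Harnack's inequality on the discs
`z ↦ (σ w n)_{n ∉ S}, (z w n)_{n ∈ S}`. -/
theorem lintegral_negLog_le_of_rotate (S : Set ℕ) {σ σ' : InfTorus → ℕ → ℂ} (hσc : Continuous σ)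
    (hσ : ∀ w, σ w ∈ polydisc) (hσS : ∀ w, ∀ n ∈ S, σ w n = w n)
    (hσT : ∀ w w' : InfTorus, (∀ n ∉ S, w n = w' n) → ∀ n ∉ S, σ w n = σ w' n)
    {ρ : ℝ} (hρ : ρ < 1) {e : InfTorus → ℂ} (he : ∀ w, ‖e w‖ = ρ)
    (hS' : ∀ w, ∀ n ∈ S, σ' w n = e w * w n) (hT' : ∀ w, ∀ n ∉ S, σ' w n = σ w n) :
    ∫⁻ w, negLog (G (σ w)) ∂(normHaar InfTorus)
      ≤ ENNReal.ofReal ((1 + ρ) / (1 - ρ)) * ∫⁻ w, negLog (G (σ' w)) ∂(normHaar InfTorus) := by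
  classical
  let θ : Circle → InfTorus := fun l n => if n ∈ S then l else 1
  have hθ : Measurable θ := by
    refine (continuous_pi fun n => ?_).measurable
    by_cases hn : n ∈ S
    · simpa [θ, hn] using continuous_id'
    · simpa [θ, hn] using continuous_const
  have hg : Measurable fun w => negLog (G (σ w)) :=
    measurable_negLog.comp (hGc.comp_continuous hσc hσ).measurable
  rw [← lintegral_translate (normHaar Circle) hθ hg, ← lintegral_const_mul' _ _ ENNReal.ofReal_ne_top]
  refine lintegral_mono fun w => ?_
  -- On the disc `z ↦ c + z d`, the points `z = l` are the rotated `σ` and `z = e w` is `σ' w`.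
  set c : ℕ → ℂ := fun n => if n ∈ S then 0 else σ w n with hc
  set d : ℕ → ℂ := fun n => if n ∈ S then (w n : ℂ) else 0 with hd
  have h1 (l : Circle) : σ (θ l * w) = fun n => c n + (l : ℂ) * d n := by
    ext n
    by_cases hn : n ∈ S
    · simp [hσS _ n hn, θ, hn, hc, hd]
    · have := hσT (θ l * w) w (fun n hn => by simp [θ, hn]) n hn
      simp [this, hn, hc, hd]
  have h2 : σ' w = fun n => c n + e w * d n := by
    ext n
    by_cases hn : n ∈ S
    · simp [hS' _ n hn, hn, hc, hd]
    · simp [hT' _ n hn, hn, hc, hd]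
  have hmem : ∀ z ∈ Metric.closedBall (0 : ℂ) 1, (fun n => c n + z * d n) ∈ polydisc := by
    intro z hz
    rw [mem_polydisc]
    intro n
    by_cases hn : n ∈ S
    · simpa [hn, hc, hd, Circle.norm_coe] using hz
    · simpa [hn, hc, hd] using mem_polydisc.1 (hσ w) n
  have hdiff := hGd c d hmem
  simp only [h1, h2]
  rw [← he w]
  refine lintegral_negLog_le_mul (f := fun z => G fun n => c n + z * d n) ?_ (fun l => ?_)
    (by rw [he]; exact hρ)
  · exact DifferentiableOn.diffContOnCl (by rwa [closure_ball _ one_ne_zero])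
  · exact hG1 _ (hmem _ (by simp [Circle.norm_coe]))

/-- If `G` is nonzero at some point of the open polydisc with finitely many nonzero coordinates,
then `log |G|` is integrable on the torus. -/
theorem lintegral_negLog_polydisc_lt_top {b : ℕ → ℂ} (hb : ∀ n, ‖b n‖ < 1) {N : ℕ}
    (hbN : ∀ n, N ≤ n → b n = 0) (hGb : G b ≠ 0) :
    ∫⁻ w : InfTorus, negLog (G fun n => w n) ∂(normHaar InfTorus) < ∞ := by
  have hcont (k : ℕ) : Continuous fun (w : InfTorus) n => if n < k then (w n : ℂ) else b n := by
    refine continuous_pi fun n => ?_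
    by_cases hn : n < k
    · simp only [hn, if_true]; fun_prop
    · simpa only [hn, if_false] using continuous_const
  have hpoly (k : ℕ) (w : InfTorus) : (fun n => if n < k then (w n : ℂ) else b n) ∈ polydisc := by
    rw [mem_polydisc]
    intro n
    by_cases hn : n < k
    · simp [hn, Circle.norm_coe]
    · simpa [hn] using (hb n).le
  -- Each step moves coordinate `k` from `b k` to the circle, at the cost of a finite factor
  -- depending on `‖b k‖`.
  have step (k : ℕ) : ∫⁻ w : InfTorus, negLog (G fun n => if n < k then (w n : ℂ) else b n)
      ∂(normHaar InfTorus) < ∞ := by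
    induction k with
    | zero => simpa using negLog_lt_top hGb
    | succ k ih =>
      refine (lintegral_negLog_le_of_rotate hGc hGd hG1 {k}
        (σ' := fun w n => if n < k then (w n : ℂ) else b n) (e := fun w => b k / w k)
        (hcont (k + 1)) (hpoly (k + 1)) ?_ ?_ (hb k) ?_ ?_ ?_).trans_lt
        (ENNReal.mul_lt_top ENNReal.ofReal_lt_top ih)
      · rintro w n rfl; simp
      · intro w w' h n hn; simp only [h n hn]
      · intro w; simp [Circle.norm_coe]
      · rintro w n rfl; simp
      · intro w n hn
        have hn : n ≠ k := hn
        have : n < k ↔ n < k + 1 := by omega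
        simp only [this]
  -- The infinitely many coordinates where `b` vanishes move together from the centre of the disc,
  -- with factor 1.
  refine (lintegral_negLog_le_of_rotate hGc hGd hG1 {n | N ≤ n}
    (σ := fun w n => (w n : ℂ))
    (σ' := fun w n => if n < N then (w n : ℂ) else b n) (e := fun _ => 0) (ρ := 0)
    (continuous_pi fun n => by fun_prop) ?_ ?_ ?_ one_pos ?_ ?_ ?_).trans_lt
    (ENNReal.mul_lt_top ENNReal.ofReal_lt_top (step N))
  · intro w; rw [mem_polydisc]; intro n; simp [Circle.norm_coe]
  · intro w n _; rfl
  · intro w w' h n hn; rw [h n hn]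
  · simp
  · intro w n hn
    have hn : N ≤ n := hn
    simp [hn.not_gt, hbN n hn]
  · intro w n hn
    have hn : ¬ N ≤ n := hn
    simp [not_le.1 hn]

end Polydisc

variable {F : EllOne → ℂ}

/-- Truncations of `ζ` converge to it in `ℓ¹`, and `F` is continuous. -/
theorem exists_finite_support_ne_zero (hF : HolomorphicOn F discOne)
    (hF0 : ∃ ζ ∈ discOne, F ζ ≠ 0) :
    ∃ (N : ℕ) (a : ℕ → ℂ), (∀ n, ‖a n‖ < 1) ∧ (∀ n, N ≤ n → a n = 0) ∧ F (ofSeq a) ≠ 0 := by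
  obtain ⟨ζ, hζ, h0⟩ := hF0
  have h1 := (hasSum_ofSeq_coe ζ).tendsto_sum_nat
  obtain ⟨N, hN⟩ := (((hF.continuousAt isOpen_discOne hζ).tendsto.comp h1).eventually_ne h0).exists
  refine ⟨N, fun n => if n < N then ζ n else 0, fun n => ?_, fun n hn => by simp [hn.not_gt], ?_⟩
  · by_cases hn : n < N
    · simpa [hn] using hζ n
    · simp [hn]
  · convert hN using 1
    rw [Function.comp_apply, ofSeq, tsum_eq_sum (s := Finset.range N)]
    congr 1
    · exact Finset.sum_congr rfl fun n hn => by rw [if_pos (Finset.mem_range.1 hn)]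
    · intro n hn
      rw [if_neg (by simpa using hn), map_zero]

theorem exists_radius_lt {a : ℕ → ℂ} (ha : ∀ n, ‖a n‖ < 1) {N : ℕ} (haN : ∀ n, N ≤ n → a n = 0) :
    ∃ r ∈ Set.Ioo (0 : ℝ) 1, ∀ n, ‖a n‖ < r ^ (n + 1) := by
  have h1 : ∀ᶠ r : ℝ in 𝓝[<] 1, ∀ n ∈ Finset.range N, ‖a n‖ < r ^ (n + 1) := by
    rw [Filter.eventually_all_finset]
    intro n _
    have h : Tendsto (fun r : ℝ => r ^ (n + 1)) (𝓝[<] 1) (𝓝 1) := by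
      have := (continuous_pow (M := ℝ) (n + 1)).tendsto 1
      rw [one_pow] at this
      exact this.mono_left nhdsWithin_le_nhds
    exact h.eventually_const_lt (ha n)
  obtain ⟨r, hr, hr01⟩ := (h1.and (Ioo_mem_nhdsLT zero_lt_one)).exists
  refine ⟨r, hr01, fun n => ?_⟩
  by_cases hn : n < N
  · exact hr n (Finset.mem_range.2 hn)
  · rw [haN n (not_lt.1 hn), norm_zero]; exact pow_pos hr01.1 _

theorem negLog_le_div (z : ℂ) {M : ℝ} (hM : 1 ≤ M) : negLog z ≤ negLog (z / M) := by
  refine iSup_mono fun k => ENNReal.ofReal_le_ofReal (neg_le_neg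
    (Real.log_le_log ((Real.exp_pos _).trans_le (le_max_right _ _)) ?_))
  have : ‖z / M‖ ≤ ‖z‖ := by
    rw [norm_div, Complex.norm_real, Real.norm_of_nonneg (by linarith)]
    exact div_le_self (norm_nonneg _) hM
  gcongr

/-- The weights `r ^ (n + 1)` carry the compact polydisc continuously into `discOne`, so `F_{[r]}`
extends to a bounded function there. With `r` close to 1 the nonvanishing point of `F` comes from
inside the open polydisc. -/
theorem exists_lintegral_negLog_dilation_lt_top (hF : HolomorphicOn F discOne)
    (hF0 : ∃ ζ ∈ discOne, F ζ ≠ 0) :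
    ∃ r ∈ Set.Ioo (0 : ℝ) 1, ∫⁻ w, negLog (dilation F r w) ∂(normHaar InfTorus) < ∞ := by
  obtain ⟨N, a, ha1, haN, hFa⟩ := exists_finite_support_ne_zero hF hF0
  obtain ⟨r, hr, har⟩ := exists_radius_lt ha1 haN
  refine ⟨r, hr, ?_⟩
  have hr' : ‖(r : ℂ)‖ < 1 := by simpa [abs_of_pos hr.1] using hr.2
  have hrn : ‖(r : ℂ)‖ = r := by simp [abs_of_pos hr.1]
  have hr0 : (r : ℂ) ≠ 0 := by exact_mod_cast hr.1.ne'
  have hu := summable_pow_succ hr.1.le hr.2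
  set P : (ℕ → ℂ) → EllOne := fun c => ofSeq fun n => (r : ℂ) ^ (n + 1) * c n with hP
  have hsum {c : ℕ → ℂ} {B : ℝ} (hc : ∀ n, ‖c n‖ ≤ B) :
      Summable fun n => ‖(r : ℂ) ^ (n + 1) * c n‖ := by
    refine Summable.of_nonneg_of_le (fun _ => norm_nonneg _) (fun n => ?_) (hu.mul_right B)
    rw [norm_mul, norm_pow, hrn]
    exact mul_le_mul_of_nonneg_left (hc n) (pow_nonneg hr.1.le _)
  have hPmem {c : ℕ → ℂ} (hc : c ∈ polydisc) : P c ∈ discOne := by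
    rw [mem_polydisc] at hc
    intro n
    rw [hP]
    simp only
    rw [ofSeq_apply (hsum hc), norm_mul, norm_pow, hrn]
    calc _ ≤ r ^ (n + 1) * 1 := mul_le_mul_of_nonneg_left (hc n) (pow_nonneg hr.1.le _)
      _ < 1 := by rw [mul_one]; exact pow_lt_one₀ hr.1.le hr.2 (Nat.succ_ne_zero n)
  have hPc : ContinuousOn P polydisc := by
    refine continuousOn_ofSeq (fun n => Continuous.continuousOn (by fun_prop)) hu fun n c hc => ?_
    rw [norm_mul, norm_pow, hrn]
    exact mul_le_of_le_one_right (pow_nonneg hr.1.le _) (mem_polydisc.1 hc n)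
  have hFP : ContinuousOn (fun c => F (P c)) polydisc :=
    hF.continuousOn_discOne.comp hPc fun c hc => hPmem hc
  obtain ⟨C, hC⟩ := isCompact_polydisc.exists_bound_of_continuousOn hFP
  set M := max C 1 with hM
  have hM1 : 1 ≤ M := le_max_right _ _
  have hM0 : (M : ℂ) ≠ 0 := by exact_mod_cast (by linarith : (0 : ℝ) < M).ne'
  have key := lintegral_negLog_polydisc_lt_top (G := fun c => F (P c) / M) (hFP.div_const _)
    ?_ ?_ (b := fun n => a n / (r : ℂ) ^ (n + 1)) ?_ (N := N) ?_ ?_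
  · refine lt_of_le_of_lt (lintegral_mono fun w => ?_) key
    rw [dilation, starPoint_eq_ofSeq hr']
    exact negLog_le_div _ hM1
  · intro c d hcd
    have hc (n : ℕ) : ‖c n‖ ≤ 1 := by
      simpa using mem_polydisc.1 (hcd 0 (by simp)) n
    have hd (n : ℕ) : ‖d n‖ ≤ 2 := by
      have h := mem_polydisc.1 (hcd 1 (by simp)) n
      simp only [one_mul] at h
      have h2 := norm_sub_le (c n + d n) (c n)
      rw [add_sub_cancel_left] at h2
      linarith [hc n]
    have hlin (z : ℂ) : P (fun n => c n + z * d n) = P c + z • P d := by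
      rw [hP]
      simp only
      rw [← ofSeq_add_smul (hsum hc) (hsum hd)]
      congr 1; ext n; ring
    refine DifferentiableOn.div_const ?_ _
    simp only [hlin]
    refine (hF.2 (P c) (hPmem (mem_polydisc.2 hc)) (P d)).mono fun z hz => ?_
    simp only [Set.mem_ofPred_eq, ← hlin]
    exact hPmem (hcd z hz)
  · intro c hc
    rw [norm_div, Complex.norm_real, Real.norm_of_nonneg (by linarith), div_le_one (by linarith)]
    exact (hC c hc).trans (le_max_left _ _)
  · intro n
    rw [norm_div, norm_pow, hrn, div_lt_one (pow_pos hr.1 _)]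
    exact har n
  · intro n hn; simp [haN n hn]
  · refine div_ne_zero ?_ hM0
    rw [hP]
    simp only
    have : (fun n => (r : ℂ) ^ (n + 1) * (a n / (r : ℂ) ^ (n + 1))) = a := by
      ext n; field_simp
    rwa [this]

/-! ### From slices back to the torus. -/

theorem lintegral_slice {F : EllOne → ℂ} (hF : HolomorphicOn F discOne) {r : ℝ}
    (hr : r ∈ Set.Ioo (0 : ℝ) 1) {Φ : ℂ → ℝ≥0∞} (hΦ : Measurable Φ) :
    ∫⁻ w, ∫⁻ l : Circle, Φ (slice F w (r * l)) ∂(normHaar Circle) ∂(normHaar InfTorus)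
      = ∫⁻ w, Φ (dilation F r w) ∂(normHaar InfTorus) := by
  simp only [slice_mul_circle F _ hr]
  exact lintegral_translate (normHaar Circle) measurable_powers
    (g := fun w => Φ (dilation F r w)) (hΦ.comp (hF.continuous_dilation hr).measurable)

theorem measurable_lintegral_slice {F : EllOne → ℂ} (hF : HolomorphicOn F discOne) {r : ℝ}
    (hr : r ∈ Set.Ioo (0 : ℝ) 1) {Φ : ℂ → ℝ≥0∞} (hΦ : Measurable Φ) :
    Measurable fun w => ∫⁻ l : Circle, Φ (slice F w (r * l)) ∂(normHaar Circle) := by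
  simp only [slice_mul_circle F _ hr]
  refine Measurable.lintegral_prod_right' (f := fun q : InfTorus × Circle =>
    Φ (dilation F r (powers q.2 * q.1))) ?_
  exact (hΦ.comp (hF.continuous_dilation hr).measurable).comp
    ((measurable_powers.comp measurable_snd).mul measurable_fst)

theorem measurable_ofReal_posLog_norm : Measurable fun z : ℂ => ENNReal.ofReal (Real.posLog ‖z‖) :=
  (continuous_posLog_norm continuous_id').measurable.ennreal_ofReal

theorem mul_mul_circle_eq {r ρ : ℝ} (hρ : ρ ≠ 0) (l : Circle) :
    (ρ : ℂ) * (((r / ρ : ℝ) : ℂ) * l) = r * l := by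
  have : (ρ : ℂ) ≠ 0 := by exact_mod_cast hρ
  push_cast; field_simp

theorem norm_ofReal_div_le_one {r ρ : ℝ} (hr : 0 ≤ r) (h : r ≤ ρ) : ‖((r / ρ : ℝ) : ℂ)‖ ≤ 1 := by
  rw [Complex.norm_real, Real.norm_of_nonneg (div_nonneg hr (hr.trans h))]
  exact div_le_one_of_le₀ h (hr.trans h)

theorem lintegral_posLog_circle_mono {f : ℂ → ℂ} (hf : DifferentiableOn ℂ f (Metric.ball 0 1))
    {r ρ : ℝ} (hr : 0 ≤ r) (h : r ≤ ρ) (hρ : ρ ∈ Set.Ioo (0 : ℝ) 1) :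
    ∫⁻ l : Circle, ENNReal.ofReal (Real.posLog ‖f (r * l)‖) ∂(normHaar Circle)
      ≤ ∫⁻ l : Circle, ENNReal.ofReal (Real.posLog ‖f (ρ * l)‖) ∂(normHaar Circle) := by
  have hd := diffContOnCl_comp_mul hf (r := ρ) (by simpa [abs_of_pos hρ.1] using hρ.2)
  simpa only [mul_mul_circle_eq hρ.1.ne'] using
    lintegral_posLog_le hd (norm_ofReal_div_le_one hr h)

theorem lintegral_negLog_circle_le {f : ℂ → ℂ} (hf : DifferentiableOn ℂ f (Metric.ball 0 1))
    {r ρ : ℝ} (hr : 0 ≤ r) (h : r ≤ ρ) (hρ : ρ ∈ Set.Ioo (0 : ℝ) 1) :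
    ∫⁻ l : Circle, negLog (f (ρ * l)) ∂(normHaar Circle)
      ≤ ∫⁻ l : Circle, ENNReal.ofReal (Real.posLog ‖f (ρ * l)‖) ∂(normHaar Circle)
        + ∫⁻ l : Circle, negLog (f (r * l)) ∂(normHaar Circle) := by
  have hd := diffContOnCl_comp_mul hf (r := ρ) (by simpa [abs_of_pos hρ.1] using hρ.2)
  simpa only [mul_mul_circle_eq hρ.1.ne'] using
    lintegral_negLog_le hd (norm_ofReal_div_le_one hr h)

theorem radius_monotone : Monotone radius := by
  intro m n hmn
  unfold radius
  gcongr

theorem eventually_le_radius {r : ℝ} (hr : r < 1) : ∀ᶠ n in atTop, r ≤ radius n :=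
  ((tendsto_radius.mono_right nhdsWithin_le_nhds).eventually_const_lt hr).mono fun _ h => h.le

/-- Circle means increase with the radius, so the supremum may be taken along `radius n` and
commutes with integration over `w`. -/
theorem NevanlinnaInf.ae_nevanlinnaDisc_slice {F : EllOne → ℂ} (hF : NevanlinnaInf F) :
    ∀ᵐ w ∂(normHaar InfTorus), NevanlinnaDisc (slice F w) := by
  obtain ⟨hol, hC⟩ := hF
  have hm (n : ℕ) := measurable_lintegral_slice hol (radius_mem n) measurable_ofReal_posLog_norm
  have hint : ∫⁻ w, ⨆ n, ∫⁻ l : Circle, ENNReal.ofReal (Real.posLog ‖slice F w (radius n * l)‖)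
      ∂(normHaar Circle) ∂(normHaar InfTorus) < ∞ := by
    rw [lintegral_iSup hm fun m n hmn w => lintegral_posLog_circle_mono
      (hol.differentiableOn_slice w) (radius_mem m).1.le (radius_monotone hmn) (radius_mem n)]
    refine lt_of_le_of_lt (iSup_le fun n => ?_) hC
    rw [lintegral_slice hol (radius_mem n) measurable_ofReal_posLog_norm]
    exact le_iSup₂ (f := fun (r : ℝ) (_ : r ∈ Set.Ioo (0 : ℝ) 1) =>
      ∫⁻ w, ENNReal.ofReal (Real.posLog ‖dilation F r w‖) ∂(normHaar InfTorus))
      (radius n) (radius_mem n)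
  filter_upwards [ae_lt_top (.iSup hm) hint.ne] with w hw
  refine ⟨hol.differentiableOn_slice w, lt_of_le_of_lt (iSup₂_le fun r hr => ?_) hw⟩
  obtain ⟨n, hn⟩ := (eventually_le_radius hr.2).exists
  exact (lintegral_posLog_circle_mono (hol.differentiableOn_slice w) hr.1.le hn
    (radius_mem n)).trans (le_iSup (fun n => ∫⁻ l : Circle, ENNReal.ofReal
      (Real.posLog ‖slice F w (radius n * l)‖) ∂(normHaar Circle)) n)

theorem NevanlinnaInf.ae_tendsto_radialLimit {F : EllOne → ℂ} (hF : NevanlinnaInf F) :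
    ∀ᵐ w ∂(normHaar InfTorus), Tendsto (fun r : ℝ => dilation F r w) (𝓝[<] (1 : ℝ))
      (𝓝 (radialLimit F w)) := by
  have hE := measurableSet_exists_tendsto_left (g := dilation F)
    (fun r hr => (hF.1.continuous_dilation hr).measurable) hF.1.continuousOn_dilation
  have h := ae_of_ae_translate (normHaar Circle) measurable_powers hE ?_
  · filter_upwards [h] with w hw
    exact tendsto_nhds_limUnder hw
  · filter_upwards [hF.ae_nevanlinnaDisc_slice] with w hw
    filter_upwards [hw.ae_radialLimit] with l ⟨c, hc⟩
    refine ⟨c, hc.congr' ?_⟩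
    filter_upwards [Ioo_mem_nhdsLT zero_lt_one] with r hr using slice_mul_circle F w hr l

theorem NevanlinnaInf.lintegral_radialLimit_lt_top {F : EllOne → ℂ} (hF : NevanlinnaInf F)
    (hF0 : ∃ ζ ∈ discOne, F ζ ≠ 0) :
    ∫⁻ w, ENNReal.ofReal (Real.posLog ‖radialLimit F w‖) ∂(normHaar InfTorus) < ∞ ∧
    ∫⁻ w, negLog (radialLimit F w) ∂(normHaar InfTorus) < ∞ := by
  have hlim := hF.ae_tendsto_radialLimit
  obtain ⟨hol, hC⟩ := hF
  set C := ⨆ r ∈ Set.Ioo (0 : ℝ) 1,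
    ∫⁻ w, ENNReal.ofReal (Real.posLog ‖dilation F r w‖) ∂(normHaar InfTorus) with hCdef
  have hCr {r : ℝ} (hr : r ∈ Set.Ioo (0 : ℝ) 1) :
      ∫⁻ w, ENNReal.ofReal (Real.posLog ‖dilation F r w‖) ∂(normHaar InfTorus) ≤ C :=
    le_iSup₂ (f := fun (r : ℝ) (_ : r ∈ Set.Ioo (0 : ℝ) 1) =>
      ∫⁻ w, ENNReal.ofReal (Real.posLog ‖dilation F r w‖) ∂(normHaar InfTorus)) r hr
  have hmeas (n : ℕ) : Measurable (dilation F (radius n)) :=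
    (hol.continuous_dilation (radius_mem n)).measurable
  obtain ⟨s, hs, hsD⟩ := exists_lintegral_negLog_dilation_lt_top hol hF0
  constructor
  · refine lt_of_le_of_lt ?_ hC
    calc _ ≤ ∫⁻ w, liminf (fun n => ENNReal.ofReal (Real.posLog ‖dilation F (radius n) w‖)) atTop
          ∂(normHaar InfTorus) := by
          refine lintegral_mono_ae ?_
          filter_upwards [hlim] with w hw
          have h : Tendsto (fun n => ENNReal.ofReal (Real.posLog ‖dilation F (radius n) w‖)) atTop
              (𝓝 (ENNReal.ofReal (Real.posLog ‖radialLimit F w‖))) :=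
            ENNReal.tendsto_ofReal
              (((continuous_posLog_norm continuous_id').tendsto _).comp (hw.comp tendsto_radius))
          exact h.liminf_eq.ge
      _ ≤ _ := lintegral_liminf_le fun n => measurable_ofReal_posLog_norm.comp (hmeas n)
      _ ≤ C := liminf_le_of_frequently_le' (.of_forall fun n => hCr (radius_mem n))
  -- Jensen's inequality between radii `s` and `r` on each slice, integrated over the torus.
  · have hbound {r : ℝ} (hr : r ∈ Set.Ioo (0 : ℝ) 1) (hsr : s ≤ r) :
        ∫⁻ w, negLog (dilation F r w) ∂(normHaar InfTorus)
          ≤ C + ∫⁻ w, negLog (dilation F s w) ∂(normHaar InfTorus) := by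
      rw [← lintegral_slice hol hr measurable_negLog, ← lintegral_slice hol hs measurable_negLog]
      refine (lintegral_mono fun w => lintegral_negLog_circle_le (hol.differentiableOn_slice w)
        hs.1.le hsr hr).trans ?_
      rw [lintegral_add_left
        (measurable_lintegral_slice hol hr measurable_ofReal_posLog_norm),
        lintegral_slice hol hr measurable_ofReal_posLog_norm]
      gcongr
      exact hCr hr
    refine lt_of_le_of_lt ?_ (ENNReal.add_lt_top.2 ⟨hC, hsD⟩)
    calc _ ≤ ∫⁻ w, liminf (fun n => negLog (dilation F (radius n) w)) atTop
          ∂(normHaar InfTorus) := by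
          refine lintegral_mono_ae ?_
          filter_upwards [hlim] with w hw using negLog_le_liminf (hw.comp tendsto_radius)
      _ ≤ _ := lintegral_liminf_le fun n => measurable_negLog.comp (hmeas n)
      _ ≤ _ := by
        refine liminf_le_of_frequently_le' (Eventually.frequently ?_)
        filter_upwards [eventually_le_radius hs.2] with n hn using hbound (radius_mem n) hn

theorem NevanlinnaInf.aemeasurable_radialLimit {F : EllOne → ℂ} (hF : NevanlinnaInf F) :
    AEMeasurable (radialLimit F) (normHaar InfTorus) := by
  refine aemeasurable_of_tendsto_metrizable_ae (u := atTop) (f := fun n => dilation F (radius n))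
    (fun n => (hF.1.continuous_dilation (radius_mem n)).measurable.aemeasurable) ?_
  filter_upwards [hF.ae_tendsto_radialLimit] with w hw using hw.comp tendsto_radius

end InfNevanlinna

end

theorem theorem2p4 (F : InfNevanlinna.EllOne → ℂ) (hF : InfNevanlinna.NevanlinnaInf F)
    (hF0 : ∃ ζ ∈ InfNevanlinna.discOne, F ζ ≠ 0) :
    (∀ᵐ w ∂(InfNevanlinna.normHaar InfNevanlinna.InfTorus),
      InfNevanlinna.NevanlinnaDisc (InfNevanlinna.slice F w)) ∧
    (∀ᵐ w ∂(InfNevanlinna.normHaar InfNevanlinna.InfTorus),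
      Tendsto (fun r : ℝ => InfNevanlinna.dilation F r w) (𝓝[<] (1 : ℝ))
        (𝓝 (InfNevanlinna.radialLimit F w))) ∧
    (∀ᵐ w ∂(InfNevanlinna.normHaar InfNevanlinna.InfTorus),
      InfNevanlinna.radialLimit F w ≠ 0) ∧
    Integrable (fun w => Real.log ‖InfNevanlinna.radialLimit F w‖)
      (InfNevanlinna.normHaar InfNevanlinna.InfTorus) := by
  obtain ⟨h1, h2⟩ := hF.lintegral_radialLimit_lt_top hF0
  have hm := hF.aemeasurable_radialLimit
  have hL : AEMeasurable (fun w => InfNevanlinna.negLog (InfNevanlinna.radialLimit F w))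
      (InfNevanlinna.normHaar InfNevanlinna.InfTorus) :=
    InfNevanlinna.measurable_negLog.comp_aemeasurable hm
  refine ⟨hF.ae_nevanlinnaDisc_slice, hF.ae_tendsto_radialLimit, ?_, ?_, ?_⟩
  -- Since `Real.log 0 = 0`, integrability of the real logarithm would not exclude zeros; finiteness
  -- of `negLog` does.
  · filter_upwards [ae_lt_top' hL h2.ne]
      with w hw h0
    rw [h0, InfNevanlinna.negLog_zero] at hw
    exact lt_irrefl _ hw
  · exact (Real.measurable_log.comp_aemeasurable hm.norm).aestronglyMeasurable
  · refine lt_of_le_of_lt (lintegral_mono fun w => InfNevanlinna.enorm_log_norm_le _) ?_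
    rw [lintegral_add_right' _ hL]
    exact ENNReal.add_lt_top.2 ⟨h1, h2⟩
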